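/- Let $0<\rho<1$ and let $N>1$ be an integer. Let $\mu_{\rho,N}$ be the unique Borel probability measure on $\mathbb R$ satisfying $$\mu_{\rho,N}(E)=\frac1N\sum_{j=0}^{N-1}\mu_{\rho,N}(\rho^{-1}E-j)\qquad\text{for every Borel set }E\subset\mathbb R.$$ Then $\mu_{\rho,N}$ is a spectral measure, i.e. there is a countable set $\Lambda\subset\mathbb R$ such that $\{e^{-2\pi i\lambda x}:\lambda\in\Lambda\}$ is an orthonormal basis of $L^2(\mu_{\rho,N})$, if and only if $\rho=\frac1q$ for some integer $q>1$ with $N\mid q$. -/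

import Mathlib

open MeasureTheory ProbabilityTheory Filter Topology

/-- `μ` satisfies the self-similarity identity with contraction ratio `ρ`, digits `0, …, N - 1` and
uniform weights: `μ(E) = (1/N) ∑_{j < N} μ(ρ⁻¹ E - j)` for every Borel set `E`. Here `ρ⁻¹ E - j` is
written as the preimage of `E` under `x ↦ ρ (x + j)`. -/
def IsUniformSelfSimilar (ρ : ℝ) (N : ℕ) (μ : Measure ℝ) : Prop :=
  ∀ E : Set ℝ, MeasurableSet E →
    μ E = (N : ENNReal)⁻¹ * ∑ j ∈ Finset.range N, μ ((fun x : ℝ => ρ * (x + j)) ⁻¹' E)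

/-- The law of an infinite sequence of independent digits, each uniform on `{0, …, N - 1}`. -/
noncomputable def digitLaw (N : ℕ) : Measure (ℕ → Fin N) :=
  Measure.infinitePi fun _ : ℕ => uniformOn (Set.univ : Set (Fin N))

/-- The sum `∑_{k ≥ 1} ρ ^ k d_k` attached to a sequence of digits. -/
noncomputable def digitSum (ρ : ℝ) (N : ℕ) (d : ℕ → Fin N) : ℝ :=
  ∑' k : ℕ, ρ ^ (k + 1) * ((d k : ℕ) : ℝ)

/-- The measure `μ_{ρ,N}`: the law of `∑_{k ≥ 1} ρ ^ k d_k`, the digits `d_k` being independent and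
uniform on `{0, …, N - 1}`. It is the unique self-similar probability measure with ratio `ρ`,
digits `0, …, N - 1` and uniform weights, see `eq_selfSimilarMeasure_iff`. -/
noncomputable def selfSimilarMeasure (ρ : ℝ) (N : ℕ) : Measure ℝ :=
  (digitLaw N).map (digitSum ρ N)

/-- `Λ` is a spectrum of `μ`: `Λ` is countable and the functions `x ↦ exp (-2 π i λ x)`, `λ ∈ Λ`,
form an orthonormal basis of `L²(μ)`. -/
def IsSpectrum (μ : Measure ℝ) (Λ : Set ℝ) : Prop :=
  Λ.Countable ∧ ∃ b : HilbertBasis Λ ℂ (Lp ℂ 2 μ), ∀ l : Λ,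
    (b l : ℝ → ℂ) =ᵐ[μ] fun x : ℝ => Complex.exp (-2 * Real.pi * Complex.I * (l : ℝ) * x)

/-- `μ` is a spectral measure: it has a spectrum. -/
def IsSpectralMeasure (μ : Measure ℝ) : Prop :=
  ∃ Λ : Set ℝ, IsSpectrum μ Λ

theorem isProbabilityMeasure_digitLaw {N : ℕ} (hN : 0 < N) : IsProbabilityMeasure (digitLaw N) := by
  have : Nonempty (Fin N) := ⟨⟨0, hN⟩⟩
  have : IsProbabilityMeasure (uniformOn (Set.univ : Set (Fin N))) :=
    isProbabilityMeasure_uniformOn Set.finite_univ Set.univ_nonempty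
  unfold digitLaw
  infer_instance

theorem summable_digitSum {ρ : ℝ} (h0 : 0 < ρ) (h1 : ρ < 1) {N : ℕ} (d : ℕ → Fin N) :
    Summable fun k : ℕ => ρ ^ (k + 1) * ((d k : ℕ) : ℝ) := by
  refine Summable.of_nonneg_of_le (fun k => by positivity) (fun k => ?_)
    ((summable_geometric_of_lt_one h0.le h1).mul_right (N : ℝ))
  have h2 : ((d k : ℕ) : ℝ) ≤ N := by exact_mod_cast (d k).2.le
  exact mul_le_mul (pow_le_pow_of_le_one h0.le h1.le (Nat.le_succ k)) h2 (by positivity)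
    (by positivity)

theorem measurable_digitSum {ρ : ℝ} (h0 : 0 < ρ) (h1 : ρ < 1) (N : ℕ) :
    Measurable (digitSum ρ N) := by
  refine measurable_of_tendsto_metrizable
    (f := fun n (d : ℕ → Fin N) => ∑ k ∈ Finset.range n, ρ ^ (k + 1) * ((d k : ℕ) : ℝ))
    (fun n => ?_) ?_
  · refine Finset.measurable_sum _ fun k _ => Measurable.const_mul ?_ _
    exact (measurable_of_countable fun i : Fin N => ((i : ℕ) : ℝ)).comp (measurable_pi_apply k)
  · rw [tendsto_pi_nhds]
    exact fun d => (summable_digitSum h0 h1 d).hasSum.tendsto_sum_nat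

/-- Prepend a digit to a sequence of digits. -/
def consDigit {N : ℕ} (j : Fin N) (d : ℕ → Fin N) : ℕ → Fin N
  | 0 => j
  | n + 1 => d n

theorem measurable_consDigit {N : ℕ} (j : Fin N) : Measurable (consDigit j) := by
  refine measurable_pi_lambda _ fun n => ?_
  cases n with
  | zero => exact measurable_const
  | succ n => exact measurable_pi_apply n

theorem digitSum_consDigit {ρ : ℝ} (h0 : 0 < ρ) (h1 : ρ < 1) {N : ℕ} (j : Fin N)
    (d : ℕ → Fin N) : digitSum ρ N (consDigit j d) = ρ * (digitSum ρ N d + (j : ℕ)) := by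
  unfold digitSum
  rw [(summable_digitSum h0 h1 (consDigit j d)).tsum_eq_zero_add, mul_add, ← tsum_mul_left]
  simp only [consDigit]
  rw [add_comm]
  congr 1
  · exact tsum_congr fun k => by ring
  · ring

theorem digitLaw_eq {N : ℕ} (hN : 0 < N) :
    digitLaw N = (N : ENNReal)⁻¹ • ∑ j : Fin N, (digitLaw N).map (consDigit j) := by
  have : Nonempty (Fin N) := ⟨⟨0, hN⟩⟩
  have : IsProbabilityMeasure (uniformOn (Set.univ : Set (Fin N))) :=
    isProbabilityMeasure_uniformOn Set.finite_univ Set.univ_nonempty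
  symm
  refine Measure.eq_infinitePi _ fun s t ht => ?_
  obtain ⟨M, hM⟩ : ∃ M, s ⊆ Finset.range (M + 1) :=
    ⟨s.sup id, fun n hn => Finset.mem_range.2 (Nat.lt_succ_of_le (Finset.le_sup (f := id) hn))⟩
  set t' : ℕ → Set (Fin N) := fun n => if n ∈ s then t n else Set.univ with ht'
  have hbox : Set.pi (s : Set ℕ) t = Set.pi (Finset.range (M + 1) : Set ℕ) t' := by
    ext x
    simp only [Set.mem_pi, Finset.mem_coe, ht']
    constructor
    · intro h n _
      split_ifs with hs
      · exact h n hs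
      · trivial
    · intro h n hs
      simpa [hs] using h n (hM hs)
  have hprod : ∏ i ∈ s, uniformOn (Set.univ : Set (Fin N)) (t i)
      = ∏ i ∈ Finset.range (M + 1), uniformOn (Set.univ : Set (Fin N)) (t' i) := by
    rw [← Finset.prod_subset hM]
    · exact Finset.prod_congr rfl fun i hi => by simp [ht', hi]
    · intro i _ hi
      simp [ht', hi]
  have hpre : ∀ j : Fin N, (digitLaw N) (consDigit j ⁻¹' Set.pi (s : Set ℕ) t)
      = (t' 0).indicator 1 j *
        ∏ i ∈ Finset.range M, uniformOn (Set.univ : Set (Fin N)) (t' (i + 1)) := by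
    intro j
    by_cases hj : j ∈ t' 0
    · have : consDigit j ⁻¹' Set.pi (s : Set ℕ) t
          = Set.pi (Finset.range M : Set ℕ) fun n => t' (n + 1) := by
        rw [hbox]
        ext x
        simp only [Set.mem_preimage, Set.mem_pi, Finset.mem_coe, Finset.mem_range]
        constructor
        · intro h n hn
          exact h (n + 1) (by omega)
        · intro h n hn
          cases n with
          | zero => exact hj
          | succ n => exact h n (by omega)
      rw [this, digitLaw, Measure.infinitePi_pi _ fun i _ => MeasurableSet.of_discrete]
      simp [hj]
    · have : consDigit j ⁻¹' Set.pi (s : Set ℕ) t = ∅ := by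
        rw [hbox]
        ext x
        simp only [Set.mem_preimage, Set.mem_pi, Finset.mem_coe, Finset.mem_range,
          Set.mem_empty_iff_false, iff_false]
        exact fun h => hj (h 0 (by omega))
      simp [this, hj]
  have hmeas : MeasurableSet (Set.pi (s : Set ℕ) t) :=
    MeasurableSet.pi s.countable_toSet fun i _ => ht i
  rw [hprod, Finset.prod_range_succ', Measure.smul_apply, Measure.finsetSum_apply, smul_eq_mul]
  simp only [Measure.map_apply (measurable_consDigit _) hmeas, hpre]
  rw [← Finset.sum_mul, ← mul_assoc, mul_comm (∏ i ∈ Finset.range M, _)]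
  congr 1
  rw [uniformOn_univ, ENNReal.div_eq_inv_mul, Fintype.card_fin,
    ← lintegral_indicator_one MeasurableSet.of_discrete, lintegral_count, tsum_fintype]

theorem isProbabilityMeasure_selfSimilarMeasure {ρ : ℝ} (h0 : 0 < ρ) (h1 : ρ < 1) {N : ℕ}
    (hN : 0 < N) : IsProbabilityMeasure (selfSimilarMeasure ρ N) := by
  have := isProbabilityMeasure_digitLaw hN
  exact Measure.isProbabilityMeasure_map (measurable_digitSum h0 h1 N).aemeasurable

theorem isUniformSelfSimilar_selfSimilarMeasure {ρ : ℝ} (h0 : 0 < ρ) (h1 : ρ < 1) {N : ℕ}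
    (hN : 0 < N) : IsUniformSelfSimilar ρ N (selfSimilarMeasure ρ N) := by
  intro E hE
  have hm := measurable_digitSum h0 h1 N
  have hE' : ∀ j : ℕ, MeasurableSet ((fun x : ℝ => ρ * (x + j)) ⁻¹' E) := fun j =>
    (by fun_prop : Measurable fun x : ℝ => ρ * (x + j)) hE
  unfold selfSimilarMeasure
  rw [Measure.map_apply hm hE]
  conv_lhs => rw [digitLaw_eq hN]
  rw [Measure.smul_apply, Measure.finsetSum_apply, smul_eq_mul, Finset.sum_range]
  congr 1
  refine Finset.sum_congr rfl fun j _ => ?_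
  rw [Measure.map_apply (measurable_consDigit j) (hm hE), Measure.map_apply hm (hE' j)]
  congr 1
  ext d
  simp [digitSum_consDigit h0 h1]

theorem IsUniformSelfSimilar.eq_smul_sum_map {ρ : ℝ} {N : ℕ} {μ : Measure ℝ}
    (h : IsUniformSelfSimilar ρ N μ) :
    μ = (N : ENNReal)⁻¹ • ∑ j ∈ Finset.range N, μ.map fun x : ℝ => ρ * (x + j) := by
  ext E hE
  rw [h E hE, Measure.smul_apply, Measure.finsetSum_apply, smul_eq_mul]
  congr 1
  refine Finset.sum_congr rfl fun j _ => ?_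
  rw [Measure.map_apply (by fun_prop) hE]

theorem IsUniformSelfSimilar.charFun_eq {ρ : ℝ} {N : ℕ} {μ : Measure ℝ} [IsProbabilityMeasure μ]
    (h : IsUniformSelfSimilar ρ N μ) (t : ℝ) :
    charFun μ t = ((N : ℂ)⁻¹ * ∑ j ∈ Finset.range N, Complex.exp (ρ * t * j * Complex.I)) *
      charFun μ (ρ * t) := by
  have hint : ∀ (ν : Measure ℝ) [IsProbabilityMeasure ν],
      Integrable (fun x : ℝ => Complex.exp (t * x * Complex.I)) ν := fun ν _ =>
    Integrable.of_bound (by fun_prop) 1 (ae_of_all _ fun x => by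
      rw [← Complex.ofReal_mul, Complex.norm_exp_ofReal_mul_I])
  have hmeas : ∀ j : ℕ, Measurable fun x : ℝ => ρ * (x + j) := fun j => by fun_prop
  have : ∀ j : ℕ, IsProbabilityMeasure (μ.map fun x : ℝ => ρ * (x + j)) := fun j =>
    Measure.isProbabilityMeasure_map (hmeas j).aemeasurable
  rw [charFun_apply_real]
  conv_lhs => rw [h.eq_smul_sum_map]
  rw [integral_smul_measure, integral_finsetSum_measure fun j _ => hint _, mul_assoc,
    Finset.sum_mul]
  have : ((N : ENNReal)⁻¹).toReal = (N : ℝ)⁻¹ := by simp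
  rw [this, Complex.real_smul]
  push_cast
  congr 1
  refine Finset.sum_congr rfl fun j _ => ?_
  rw [integral_map (hmeas j).aemeasurable (by fun_prop), charFun_apply_real, ← integral_const_mul]
  refine integral_congr_ae (ae_of_all _ fun x => ?_)
  simp only
  rw [← Complex.exp_add]
  congr 1
  push_cast
  ring

/-- For `0 < ρ < 1` and `N ≥ 1`, the measure `μ_{ρ,N}` is the unique Borel probability measure on
the line with the self-similarity identity. -/
theorem eq_selfSimilarMeasure_iff {ρ : ℝ} (h0 : 0 < ρ) (h1 : ρ < 1) {N : ℕ} (hN : 0 < N)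
    (μ : Measure ℝ) :
    μ = selfSimilarMeasure ρ N ↔ IsProbabilityMeasure μ ∧ IsUniformSelfSimilar ρ N μ := by
  have hp := isProbabilityMeasure_selfSimilarMeasure h0 h1 hN
  have hs := isUniformSelfSimilar_selfSimilarMeasure h0 h1 hN
  constructor
  · rintro rfl
    exact ⟨hp, hs⟩
  rintro ⟨hμ, h⟩
  set ν := selfSimilarMeasure ρ N
  refine Measure.ext_of_charFun (funext fun t => ?_)
  have hstep : ∀ t : ℝ, ‖charFun μ t - charFun ν t‖ ≤ ‖charFun μ (ρ * t) - charFun ν (ρ * t)‖ := by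
    intro t
    rw [h.charFun_eq t, hs.charFun_eq t, ← mul_sub, norm_mul]
    refine mul_le_of_le_one_left (norm_nonneg _) ?_
    rw [norm_mul, norm_inv, Complex.norm_natCast, inv_mul_le_iff₀ (by exact_mod_cast hN), mul_one]
    refine (norm_sum_le _ _).trans (le_of_eq ?_)
    rw [Finset.sum_congr rfl fun j _ => ?_, Finset.sum_const, Finset.card_range, nsmul_one]
    have : (ρ * t * j : ℂ) = ((ρ * t * j : ℝ) : ℂ) := by push_cast; ring
    rw [this, Complex.norm_exp_ofReal_mul_I]
  have hiter : ∀ n : ℕ, ‖charFun μ t - charFun ν t‖ ≤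
      ‖charFun μ (ρ ^ n * t) - charFun ν (ρ ^ n * t)‖ := by
    intro n
    induction n with
    | zero => simp
    | succ n ih =>
      refine ih.trans ((hstep _).trans (le_of_eq ?_))
      rw [← mul_assoc, ← pow_succ']
  have hlim0 : Tendsto (fun n : ℕ => ρ ^ n * t) atTop (𝓝 0) := by
    simpa using (tendsto_pow_atTop_nhds_zero_of_lt_one h0.le h1).mul_const t
  have hc : Continuous fun s : ℝ => ‖charFun μ s - charFun ν s‖ :=
    (continuous_charFun.sub continuous_charFun).norm
  have hlim := (hc.tendsto 0).comp hlim0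
  simp only [charFun_zero, measureReal_def, measure_univ, sub_self, norm_zero] at hlim
  have := ge_of_tendsto' hlim hiter
  exact sub_eq_zero.1 (norm_le_zero_iff.1 this)

/-!
Write `θ = ρ⁻¹` and let `F` be the Fourier transform of `μ_{ρ,N}`. It is the infinite product of the
factors `expMean N (ρ ^ k t)`, `k ≥ 1`, so its zeros are the numbers `θ ^ k a / N` with `k ≥ 1` and
an integer `a` not divisible by `N`; such a zero has level `k`. In a spectrum all differences are
zeros of `F`, and `∑ |F (ξ + l)| ^ 2 = 1` for every `ξ`. The argument works with sets having these
two properties (`IsParsevalSet`).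

Necessity rests on one observation (`IsParsevalSet.norm_eq_one_of_factor`): if `μ_{ρ,N}` is a
convolution in which one factor alone makes the exponentials orthogonal, Bessel's inequality for
that factor leaves no room in Parseval's identity for the other. So no factor of `F` is superfluous,
and every level occurs among the differences.

* `θ` is rational (`IsParsevalSet.inv_eq_ratCast`). Levels cannot tend to infinity along a
  sequence of frequencies (`levels_not_tendsto`): along an ultrafilter one prime `l` accounts for all
  the coefficients `a`, and the embeddings of `ℚ(θ)` into the algebraic closure of `ℚ_[l]` show
  first that `θ` has `l`-adic norm `> 1` under each of them, then that some power of `θ` is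
  rational, and finally that a sequence of nonzero integers tends to zero. So some level recurs
  infinitely often. By pigeonhole two of the coefficients agree mod `N`, which gives a relation
  between two levels and makes a power of `θ` rational. If `r` is the least exponent with
  `θ ^ r` rational, powers of `θ` in different classes mod `r` are linearly independent over `ℚ`, so
  all differences have levels in one class mod `r`. As every level occurs, `r = 1`.
* `θ` is an integer (`IsParsevalSet.den_eq_one`). If a prime divides the denominator of `θ`,
  the frequencies grow faster than their levels (`IsParsevalSet.exists_growth`), while `F` decays at
  the rate of a power of the logarithm (`exists_decay`), because powers of a non-integer rational do
  not stay close to integers. The frequencies are then too sparse for Parseval's identity.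
* `N` divides `θ` (`IsParsevalSet.dvd_of_inv_nat`). Otherwise some roots of unity
  among the zeros of the factors are superfluous and can be split off.

Conversely, let `θ = q = N r`. Sums `∑ (-1) ^ k r q ^ k d_k` with digits `d_k < N` satisfy Parseval's
identity for the first `n` factors of `F`, and the remaining factor is bounded below on them, so
that dominated convergence gives the identity for `F` (`isParsevalSet_iUnion`). As exponentials are
total in `L²` of a finite measure, the identity for exponentials makes a spectrum
(`IsParsevalSet.isSpectrum`).
-/

/-! ### Exponentials and their uniform averages -/

/-- The character `e(t) = exp (2 π i t)` of the real line. -/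
noncomputable def expChar (t : ℝ) : ℂ := Complex.exp ((2 * Real.pi * t : ℝ) * Complex.I)

theorem expChar_add (s t : ℝ) : expChar (s + t) = expChar s * expChar t := by
  rw [expChar, expChar, expChar, ← Complex.exp_add]
  congr 1
  push_cast
  ring

theorem norm_expChar (t : ℝ) : ‖expChar t‖ = 1 := Complex.norm_exp_ofReal_mul_I _

theorem expChar_zero : expChar 0 = 1 := by simp [expChar]

theorem conj_expChar (t : ℝ) : (starRingEnd ℂ) (expChar t) = expChar (-t) := by
  rw [expChar, expChar, ← Complex.exp_conj]
  congr 1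
  rw [map_mul, Complex.conj_ofReal, Complex.conj_I]
  push_cast
  ring

theorem expChar_eq_one_iff (t : ℝ) : expChar t = 1 ↔ ∃ n : ℤ, t = n := by
  rw [expChar, Complex.exp_eq_one_iff]
  refine exists_congr fun n => ?_
  have h : ((2 * Real.pi * t : ℝ) : ℂ) * Complex.I = (t : ℂ) * (2 * Real.pi * Complex.I) := by
    push_cast; ring
  rw [h, mul_left_inj' Complex.two_pi_I_ne_zero]
  norm_cast

theorem expChar_intCast (n : ℤ) : expChar n = 1 := (expChar_eq_one_iff _).2 ⟨n, rfl⟩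

theorem expChar_nat_mul (j : ℕ) (t : ℝ) : expChar (j * t) = expChar t ^ j := by
  rw [expChar, expChar, ← Complex.exp_nat_mul]
  congr 1
  push_cast
  ring

theorem continuous_expChar : Continuous expChar := by
  unfold expChar; fun_prop

/-- The average `(1/n) ∑_{j < n} e(j t)`: the Fourier transform of the uniform law on
`{0, …, n - 1}`. -/
noncomputable def expMean (n : ℕ) (t : ℝ) : ℂ :=
  (n : ℂ)⁻¹ * ∑ j ∈ Finset.range n, expChar (j * t)

theorem expMean_eq_geom (n : ℕ) (t : ℝ) :
    expMean n t = (n : ℂ)⁻¹ * ∑ j ∈ Finset.range n, expChar t ^ j := by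
  simp only [expMean, expChar_nat_mul]

theorem norm_expMean_le_one (n : ℕ) (t : ℝ) : ‖expMean n t‖ ≤ 1 := by
  rw [expMean, norm_mul, norm_inv, Complex.norm_natCast]
  have h : ‖∑ j ∈ Finset.range n, expChar (j * t)‖ ≤ n := by
    refine (norm_sum_le _ _).trans (le_of_eq ?_)
    simp [norm_expChar]
  rcases Nat.eq_zero_or_pos n with rfl | hn
  · simp
  · rwa [inv_mul_le_iff₀ (by exact_mod_cast hn), mul_one]

theorem expMean_intCast {n : ℕ} (hn : 0 < n) (a : ℤ) : expMean n a = 1 := by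
  have : (n : ℂ) ≠ 0 := by exact_mod_cast hn.ne'
  simp [expMean_eq_geom, expChar_intCast, this]

theorem expMean_zero {n : ℕ} (hn : 0 < n) : expMean n 0 = 1 := by
  exact_mod_cast expMean_intCast hn 0

theorem expMean_add_intCast (n : ℕ) (t : ℝ) (a : ℤ) : expMean n (t + a) = expMean n t := by
  simp [expMean_eq_geom, expChar_add, expChar_intCast]

theorem continuous_expMean (n : ℕ) : Continuous (expMean n) := by
  unfold expMean
  have := continuous_expChar
  fun_prop

/-- The zeros are the `t` for which `e(t) ≠ 1` is an `n`-th root of unity. -/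
theorem expMean_eq_zero_iff {n : ℕ} (hn : 0 < n) (t : ℝ) :
    expMean n t = 0 ↔ ∃ a : ℤ, (n : ℝ) * t = a ∧ ¬ (n : ℤ) ∣ a := by
  have hn' : (n : ℂ) ≠ 0 := by exact_mod_cast hn.ne'
  have hnR : (n : ℝ) ≠ 0 := by exact_mod_cast hn.ne'
  by_cases ht : expChar t = 1
  · obtain ⟨b, rfl⟩ := (expChar_eq_one_iff t).1 ht
    rw [expMean_intCast hn]
    simp only [one_ne_zero, false_iff, not_exists, not_and, not_not]
    intro a ha
    exact ⟨b, by exact_mod_cast ha.symm⟩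
  · rw [expMean_eq_geom, geom_sum_eq ht, mul_eq_zero, div_eq_zero_iff, ← expChar_nat_mul]
    simp only [inv_eq_zero, hn', sub_eq_zero, ht, false_or, or_false]
    rw [expChar_eq_one_iff]
    refine exists_congr fun a => ?_
    simp only [iff_self_and]
    rintro ha ⟨b, rfl⟩
    apply ht
    rw [expChar_eq_one_iff]
    refine ⟨b, mul_left_cancel₀ hnR ?_⟩
    rw [ha]; push_cast; ring

theorem norm_expMean_lt_one {n : ℕ} (hn : 1 < n) {t : ℝ} (ht : ∀ a : ℤ, t ≠ a) :
    ‖expMean n t‖ < 1 := by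
  obtain ⟨m, rfl⟩ : ∃ m, n = m + 2 := ⟨n - 2, by omega⟩
  have h1 : expChar t ≠ 1 := fun h => by
    obtain ⟨a, ha⟩ := (expChar_eq_one_iff t).1 h
    exact ht a ha
  have h2 : ‖expChar t + 1‖ < 2 := by
    have := norm_add_lt_of_not_sameRay
      ((not_sameRay_iff_of_norm_eq (by rw [norm_expChar, norm_one])).2 h1)
    rw [norm_expChar, norm_one] at this
    linarith
  have h3 : ‖∑ j ∈ Finset.range m, expChar ((j + 1 + 1 : ℕ) * t)‖ ≤ m := by
    refine (norm_sum_le _ _).trans (le_of_eq ?_)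
    simp [norm_expChar]
  rw [expMean, norm_mul, norm_inv, Complex.norm_natCast,
    inv_mul_lt_iff₀ (by positivity), mul_one, Finset.sum_range_succ', Finset.sum_range_succ',
    add_assoc]
  refine (norm_add_le _ _).trans_lt ?_
  have h4 : expChar ((0 + 1 : ℕ) * t) + expChar ((0 : ℕ) * t) = expChar t + 1 := by
    simp [expChar_zero]
  rw [h4]
  push_cast at h3 ⊢
  linarith

/-- Digit sets factor: `{0, …, a b - 1} = {0, …, a - 1} + a {0, …, b - 1}`. -/
theorem expMean_mul (a b : ℕ) (t : ℝ) :
    expMean (a * b) t = expMean a t * expMean b (a * t) := by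
  have hs : ∑ j ∈ Finset.range (a * b), expChar t ^ j =
      (∑ j ∈ Finset.range a, expChar t ^ j) * ∑ j ∈ Finset.range b, (expChar t ^ a) ^ j := by
    induction b with
    | zero => simp
    | succ b ih =>
      rw [Nat.mul_succ, Finset.sum_range_add, ih, Finset.sum_range_succ, mul_add]
      congr 1
      rw [Finset.sum_mul]
      refine Finset.sum_congr rfl fun j _ => ?_
      rw [pow_add, pow_mul, mul_comm]
  rw [expMean_eq_geom, expMean_eq_geom, expMean_eq_geom, hs, expChar_nat_mul]
  push_cast
  rw [mul_inv]
  ring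

/-- `M` is the Fourier transform of a uniform average of finitely many (possibly repeated) point
masses on the line. -/
def IsTrigMean (M : ℝ → ℂ) : Prop :=
  ∃ (n : ℕ) (d : Fin n → ℝ), 0 < n ∧ ∀ t, M t = (n : ℂ)⁻¹ * ∑ s, expChar (d s * t)

theorem isTrigMean_expMean {n : ℕ} (hn : 0 < n) (c : ℝ) :
    IsTrigMean fun t => expMean n (c * t) := by
  refine ⟨n, fun j => (j : ℕ) * c, hn, fun t => ?_⟩
  simp only [expMean, Finset.sum_range, mul_assoc]

theorem isTrigMean_one : IsTrigMean fun _ => 1 := by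
  refine ⟨1, 0, one_pos, fun t => ?_⟩
  simp [expChar_zero]

theorem IsTrigMean.mul {M M' : ℝ → ℂ} (h : IsTrigMean M) (h' : IsTrigMean M') :
    IsTrigMean fun t => M t * M' t := by
  obtain ⟨n, d, hn, hd⟩ := h
  obtain ⟨n', d', hn', hd'⟩ := h'
  refine ⟨n * n', fun s => d (finProdFinEquiv.symm s).1 + d' (finProdFinEquiv.symm s).2,
    Nat.mul_pos hn hn', fun t => ?_⟩
  simp only [hd, hd']
  rw [finProdFinEquiv.symm.sum_comp
    (fun s : Fin n × Fin n' => expChar ((d s.1 + d' s.2) * t))]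
  simp only [add_mul, expChar_add]
  rw [Fintype.sum_prod_type, mul_mul_mul_comm, Finset.sum_mul_sum]
  push_cast
  rw [mul_inv]

theorem isTrigMean_prod {ι : Type*} (A : Finset ι) (M : ι → ℝ → ℂ) (h : ∀ i ∈ A, IsTrigMean (M i)) :
    IsTrigMean fun t => ∏ i ∈ A, M i t := by
  classical
  induction A using Finset.induction_on with
  | empty => simpa using isTrigMean_one
  | insert i A hi ih =>
    simp only [Finset.prod_insert hi]
    exact (h i (Finset.mem_insert_self _ _)).mul
      (ih fun j hj => h j (Finset.mem_insert_of_mem hj))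

/-- Bessel's inequality in the `L²` space of a finitely supported measure with Fourier transform
`M`, for the orthonormal family of exponentials with frequencies in `F`. -/
theorem IsTrigMean.sum_le_one {M : ℝ → ℂ} (h : IsTrigMean M) (F : Finset ℝ)
    (hF : ∀ x ∈ F, ∀ y ∈ F, x ≠ y → M (x - y) = 0) (ξ : ℝ) :
    ∑ x ∈ F, ‖M (ξ + x)‖ ^ 2 ≤ 1 := by
  obtain ⟨n, d, hn, hd⟩ := h
  have hn' : (n : ℂ) ≠ 0 := by exact_mod_cast hn.ne'
  let v : ℝ → EuclideanSpace ℂ (Fin n) := fun x =>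
    WithLp.toLp 2 fun s => ((Real.sqrt n : ℝ) : ℂ)⁻¹ * expChar (d s * -x)
  have hv : ∀ x y, inner ℂ (v x) (v y) = M (x - y) := by
    intro x y
    rw [PiLp.inner_apply, hd, Finset.mul_sum]
    refine Finset.sum_congr rfl fun s _ => ?_
    simp only [v, RCLike.inner_apply, map_mul, conj_expChar, map_inv₀, Complex.conj_ofReal]
    rw [mul_mul_mul_comm, ← mul_inv, ← Complex.ofReal_mul, Real.mul_self_sqrt (Nat.cast_nonneg n),
      ← expChar_add]
    push_cast
    congr 2
    ring
  have hM0 : M 0 = 1 := by simp [hd, expChar_zero, hn']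
  have hnorm : ∀ x, ‖v x‖ = 1 := by
    intro x
    have := inner_self_eq_norm_sq_to_K (𝕜 := ℂ) (v x)
    rw [hv, sub_self, hM0] at this
    have h2 := congrArg Complex.re this
    rw [← RCLike.ofReal_pow] at h2
    have h3 : (1 : ℝ) = ‖v x‖ ^ 2 := h2
    nlinarith [norm_nonneg (v x)]
  have ho : Orthonormal ℂ (fun x : F => v x) := by
    refine ⟨fun x => hnorm x, fun x y hxy => ?_⟩
    change inner ℂ (v x) (v y) = 0
    rw [hv]
    exact hF x x.2 y y.2 fun h => hxy (Subtype.ext h)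
  have := ho.sum_inner_products_le (v (-ξ)) (s := Finset.univ)
  simp only [hv, hnorm, one_pow] at this
  rw [← Finset.sum_coe_sort]
  simpa [add_comm] using this

/-! ### The Fourier transform of the self-similar measure -/

/-- The Fourier transform `t ↦ ∫ e(t x) dμ(x)` of `μ_{ρ,N}`. -/
noncomputable def fourierSelfSimilar (ρ : ℝ) (N : ℕ) (t : ℝ) : ℂ :=
  charFun (selfSimilarMeasure ρ N) (2 * Real.pi * t)

section
variable {ρ : ℝ} {N : ℕ}

theorem fourierSelfSimilar_step (h0 : 0 < ρ) (h1 : ρ < 1) (hN : 0 < N) (t : ℝ) :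
    fourierSelfSimilar ρ N t = expMean N (ρ * t) * fourierSelfSimilar ρ N (ρ * t) := by
  have := isProbabilityMeasure_selfSimilarMeasure h0 h1 hN
  rw [fourierSelfSimilar, (isUniformSelfSimilar_selfSimilarMeasure h0 h1 hN).charFun_eq,
    fourierSelfSimilar, expMean]
  have hc : 2 * Real.pi * (ρ * t) = ρ * (2 * Real.pi * t) := by ring
  rw [hc]
  congr 2
  refine Finset.sum_congr rfl fun j _ => ?_
  rw [expChar]
  congr 1
  push_cast
  ring

theorem fourierSelfSimilar_eq_prod (h0 : 0 < ρ) (h1 : ρ < 1) (hN : 0 < N) (n : ℕ) (t : ℝ) :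
    fourierSelfSimilar ρ N t =
      (∏ k ∈ Finset.Icc 1 n, expMean N (ρ ^ k * t)) * fourierSelfSimilar ρ N (ρ ^ n * t) := by
  induction n with
  | zero => simp
  | succ n ih =>
    rw [ih, Finset.prod_Icc_succ_top (by omega), fourierSelfSimilar_step h0 h1 hN (ρ ^ n * t),
      pow_succ', mul_assoc, mul_assoc]

theorem continuous_fourierSelfSimilar (h0 : 0 < ρ) (h1 : ρ < 1) (hN : 0 < N) :
    Continuous (fourierSelfSimilar ρ N) := by
  have := isProbabilityMeasure_selfSimilarMeasure h0 h1 hN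
  exact continuous_charFun.comp (by fun_prop)

theorem fourierSelfSimilar_zero (h0 : 0 < ρ) (h1 : ρ < 1) (hN : 0 < N) :
    fourierSelfSimilar ρ N 0 = 1 := by
  have := isProbabilityMeasure_selfSimilarMeasure h0 h1 hN
  simp [fourierSelfSimilar]

theorem norm_fourierSelfSimilar_le_one (h0 : 0 < ρ) (h1 : ρ < 1) (hN : 0 < N) (t : ℝ) :
    ‖fourierSelfSimilar ρ N t‖ ≤ 1 := by
  have := isProbabilityMeasure_selfSimilarMeasure h0 h1 hN
  exact norm_charFun_le_one _

theorem fourierSelfSimilar_ne_zero_near (h0 : 0 < ρ) (h1 : ρ < 1) (hN : 0 < N) :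
    ∀ᶠ t in 𝓝 (0 : ℝ), fourierSelfSimilar ρ N t ≠ 0 := by
  refine (continuous_fourierSelfSimilar h0 h1 hN).continuousAt.eventually_ne ?_
  rw [fourierSelfSimilar_zero h0 h1 hN]
  exact one_ne_zero

theorem norm_fourierSelfSimilar_le_prod (h0 : 0 < ρ) (h1 : ρ < 1) (hN : 0 < N) (A : Finset ℕ)
    (hA : ∀ k ∈ A, 1 ≤ k) (t : ℝ) :
    ‖fourierSelfSimilar ρ N t‖ ≤ ∏ k ∈ A, ‖expMean N (ρ ^ k * t)‖ := by
  have hsub : A ⊆ Finset.Icc 1 (A.sup id) := fun k hk =>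
    Finset.mem_Icc.2 ⟨hA k hk, Finset.le_sup (f := id) hk⟩
  rw [fourierSelfSimilar_eq_prod h0 h1 hN (A.sup id) t, norm_mul, norm_prod]
  calc _ ≤ (∏ k ∈ Finset.Icc 1 (A.sup id), ‖expMean N (ρ ^ k * t)‖) * 1 := by
        gcongr
        exact norm_fourierSelfSimilar_le_one h0 h1 hN _
    _ ≤ _ := by
        rw [mul_one, ← Finset.prod_sdiff hsub]
        exact mul_le_of_le_one_left (Finset.prod_nonneg fun _ _ => norm_nonneg _)
          (Finset.prod_le_one (fun _ _ => norm_nonneg _) fun _ _ => norm_expMean_le_one _ _)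

/-- `x` is a zero of level `k` of the Fourier transform of `μ_{ρ,N}`: a zero of its `k`-th factor
`t ↦ expMean N (ρ ^ k t)`. The factors are numbered from `1`. -/
def IsLevel (ρ : ℝ) (N : ℕ) (k : ℕ) (x : ℝ) : Prop :=
  1 ≤ k ∧ expMean N (ρ ^ k * x) = 0

theorem isLevel_iff (h0 : 0 < ρ) (hN : 0 < N) {k : ℕ} {x : ℝ} :
    IsLevel ρ N k x ↔ 1 ≤ k ∧ ∃ a : ℤ, N * x = ρ⁻¹ ^ k * a ∧ ¬ (N : ℤ) ∣ a := by
  rw [IsLevel, expMean_eq_zero_iff hN]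
  refine and_congr_right fun _ => exists_congr fun a => and_congr_left fun _ => ?_
  have : ρ ^ k ≠ 0 := pow_ne_zero _ h0.ne'
  rw [inv_pow]
  constructor
  · intro h; rw [← h]; field_simp
  · intro h; rw [mul_left_comm, h]; field_simp

theorem exists_isLevel (h0 : 0 < ρ) (h1 : ρ < 1) (hN : 0 < N) {x : ℝ}
    (hx : fourierSelfSimilar ρ N x = 0) : ∃ k, IsLevel ρ N k x := by
  have hlim : Tendsto (fun n : ℕ => ρ ^ n * x) atTop (𝓝 0) := by
    simpa using (tendsto_pow_atTop_nhds_zero_of_lt_one h0.le h1).mul_const x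
  obtain ⟨n, hn⟩ := (hlim.eventually (fourierSelfSimilar_ne_zero_near h0 h1 hN)).exists
  rw [fourierSelfSimilar_eq_prod h0 h1 hN n x, mul_eq_zero, or_iff_left hn,
    Finset.prod_eq_zero_iff] at hx
  obtain ⟨k, hk, hk'⟩ := hx
  exact ⟨k, (Finset.mem_Icc.1 hk).1, hk'⟩

theorem IsLevel.le_abs (h0 : 0 < ρ) (hN : 0 < N) {k : ℕ} {x : ℝ} (h : IsLevel ρ N k x) :
    ρ⁻¹ ^ k ≤ N * |x| := by
  obtain ⟨-, a, ha, hna⟩ := (isLevel_iff h0 hN).1 h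
  have ha0 : a ≠ 0 := by rintro rfl; exact hna (dvd_zero _)
  have h1 : (1 : ℝ) ≤ |(a : ℝ)| := by exact_mod_cast Int.one_le_abs ha0
  have hN' : (N : ℝ) * |x| = |N * x| := by rw [abs_mul, Nat.abs_cast]
  rw [hN', ha, abs_mul, abs_of_nonneg (by positivity : (0:ℝ) ≤ ρ⁻¹ ^ k)]
  exact le_mul_of_one_le_right (by positivity) h1

/-! ### Spectra in terms of the Fourier transform -/

theorem expFun_eq (l x : ℝ) :
    Complex.exp (-2 * Real.pi * Complex.I * (l : ℝ) * x) = expChar (-(l * x)) := by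
  rw [expChar]; congr 1; push_cast; ring

theorem memLp_expChar (μ : Measure ℝ) [IsFiniteMeasure μ] (l : ℝ) :
    MemLp (fun x : ℝ => expChar (-(l * x))) 2 μ := by
  refine MemLp.of_bound (C := 1) ?_ (ae_of_all _ fun x => (norm_expChar _).le)
  exact (continuous_expChar.comp (by fun_prop)).aestronglyMeasurable

/-- The exponential `x ↦ e(-l x)` as an element of `L²(μ)`. -/
noncomputable def expLp (μ : Measure ℝ) [IsFiniteMeasure μ] (l : ℝ) : Lp ℂ 2 μ :=
  (memLp_expChar μ l).toLp _

theorem inner_expLp (μ : Measure ℝ) [IsFiniteMeasure μ] (l l' : ℝ) :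
    inner ℂ (expLp μ l) (expLp μ l') = charFun μ (2 * Real.pi * (l - l')) := by
  rw [L2.inner_def, charFun_apply_real]
  refine integral_congr_ae ?_
  filter_upwards [(memLp_expChar μ l).coeFn_toLp, (memLp_expChar μ l').coeFn_toLp] with x h h'
  rw [expLp, expLp, h, h', RCLike.inner_apply, conj_expChar, ← expChar_add, expChar]
  congr 1
  push_cast
  ring

theorem inner_expLp_selfSimilar [IsFiniteMeasure (selfSimilarMeasure ρ N)] (l l' : ℝ) :
    inner ℂ (expLp (selfSimilarMeasure ρ N) l) (expLp (selfSimilarMeasure ρ N) l') =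
      fourierSelfSimilar ρ N (l - l') := inner_expLp _ _ _

theorem norm_expLp (μ : Measure ℝ) [IsProbabilityMeasure μ] (l : ℝ) : ‖expLp μ l‖ = 1 := by
  have := inner_self_eq_norm_sq_to_K (𝕜 := ℂ) (expLp μ l)
  rw [inner_expLp, sub_self, mul_zero, charFun_zero] at this
  simp only [measureReal_def, measure_univ] at this
  have h2 := congrArg Complex.re this
  rw [← RCLike.ofReal_pow] at h2
  have h3 : (1 : ℝ) = ‖expLp μ l‖ ^ 2 := h2
  nlinarith [norm_nonneg (expLp μ l)]

/-- The two consequences of spectrality used below: differences of frequencies are zeros of the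
Fourier transform, and Parseval's identity holds for all exponentials. -/
theorem IsSpectrum.zero_and_hasSum (h0 : 0 < ρ) (h1 : ρ < 1) (hN : 0 < N) {Λ : Set ℝ}
    (h : IsSpectrum (selfSimilarMeasure ρ N) Λ) :
    (∀ x ∈ Λ, ∀ y ∈ Λ, x ≠ y → fourierSelfSimilar ρ N (x - y) = 0) ∧
      ∀ ξ, HasSum (fun l : Λ => ‖fourierSelfSimilar ρ N (ξ + l)‖ ^ 2) 1 := by
  have := isProbabilityMeasure_selfSimilarMeasure h0 h1 hN
  obtain ⟨-, b, hb⟩ := h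
  have hbe : ∀ l : Λ, b l = expLp (selfSimilarMeasure ρ N) l := by
    intro l
    refine Lp.ext ((hb l).trans ?_)
    filter_upwards [(memLp_expChar (selfSimilarMeasure ρ N) l).coeFn_toLp] with x hx
    rw [expLp, hx, expFun_eq]
  constructor
  · intro x hx y hy hxy
    have := b.orthonormal.2 (i := ⟨x, hx⟩) (j := ⟨y, hy⟩) (by simpa using hxy)
    change inner ℂ (b ⟨x, hx⟩) (b ⟨y, hy⟩) = 0 at this
    rwa [hbe, hbe, inner_expLp_selfSimilar] at this
  · intro ξ
    have := b.hasSum_inner_mul_inner (expLp _ (-ξ)) (expLp _ (-ξ))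
    rw [inner_self_eq_norm_sq_to_K, norm_expLp] at this
    simp only [hbe, inner_expLp_selfSimilar] at this
    have h2 : ∀ l : Λ, fourierSelfSimilar ρ N (-ξ - l) * fourierSelfSimilar ρ N (l - -ξ) =
        ((‖fourierSelfSimilar ρ N (ξ + l)‖ ^ 2 : ℝ) : ℂ) := by
      intro l
      have h3 : fourierSelfSimilar ρ N (-ξ - l) =
          (starRingEnd ℂ) (fourierSelfSimilar ρ N (ξ + l)) := by
        rw [fourierSelfSimilar, fourierSelfSimilar, ← charFun_neg]
        congr 1; ring
      rw [h3, sub_neg_eq_add, add_comm (l : ℝ) ξ, Complex.conj_mul']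
      push_cast; rfl
    simp only [h2] at this
    have h4 : ((1 : ℝ) : ℂ) = ((1 : ℝ) : ℂ) ^ 2 := by norm_num
    erw [← h4] at this
    exact_mod_cast this

end

/-! ### Parseval sets -/

/-- The exponentials with frequencies in `Λ` are orthogonal in `L²(μ_{ρ,N})`, and all exponentials
satisfy Parseval's identity with respect to them. For countable `Λ` this is equivalent to `Λ` being
a spectrum, but it only speaks of the Fourier transform. -/
def IsParsevalSet (ρ : ℝ) (N : ℕ) (Λ : Set ℝ) : Prop :=
  (∀ x ∈ Λ, ∀ y ∈ Λ, x ≠ y → fourierSelfSimilar ρ N (x - y) = 0) ∧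
    ∀ ξ, HasSum (fun l : Λ => ‖fourierSelfSimilar ρ N (ξ + l)‖ ^ 2) 1

section
variable {ρ : ℝ} {N : ℕ} {Λ : Set ℝ}

theorem IsParsevalSet.nonempty (h : IsParsevalSet ρ N Λ) : Λ.Nonempty := by
  by_contra hne
  rw [Set.not_nonempty_iff_eq_empty] at hne
  subst hne
  have := (h.2 0).tsum_eq
  simp at this

/-- If `μ = ν * σ` and the frequencies are orthogonal already for `ν`, then Bessel's inequality for
`ν` leaves no room in Parseval's identity for `μ` unless the transform `r` of `σ` is unimodular
wherever that of `μ` does not vanish. Only finite families are tested against `ν`, so `ν` may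
depend on the family and be replaced by a finitely supported measure. -/
theorem IsParsevalSet.norm_eq_one_of_factor (h : IsParsevalSet ρ N Λ) (r : ℝ → ℂ)
    (hr : ∀ t, ‖r t‖ ≤ 1)
    (hM : ∀ F : Finset ℝ, ↑F ⊆ Λ → ∃ M, IsTrigMean M ∧
      (∀ x ∈ F, ∀ y ∈ F, x ≠ y → M (x - y) = 0) ∧
      ∀ t, ‖fourierSelfSimilar ρ N t‖ ≤ ‖M t‖ * ‖r t‖)
    {t : ℝ} (ht : fourierSelfSimilar ρ N t ≠ 0) : ‖r t‖ = 1 := by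
  classical
  obtain ⟨l₀, hl₀⟩ := h.nonempty
  set f := fourierSelfSimilar ρ N
  -- the shift by `l₀` makes `t` one of the sampled points, where the factor `r t` is lost
  have key : ∀ s : Finset Λ, {⟨l₀, hl₀⟩} ≤ s →
      ∑ l ∈ s, ‖f (t - l₀ + l)‖ ^ 2 ≤ 1 - ‖f t‖ ^ 2 * (1 - ‖r t‖ ^ 2) := by
    intro s hs
    obtain ⟨M, hM1, hM2, hM3⟩ := hM (s.map (Function.Embedding.subtype _)) (by simp)
    have hb := hM1.sum_le_one _ hM2 (t - l₀)
    rw [Finset.sum_map] at hb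
    simp only [Function.Embedding.subtype_apply] at hb
    have hmem : (⟨l₀, hl₀⟩ : Λ) ∈ s := hs (Finset.mem_singleton_self _)
    rw [← Finset.add_sum_erase _ _ hmem] at hb ⊢
    simp only [sub_add_cancel] at hb ⊢
    have hfM : ∀ u, ‖f u‖ ≤ ‖M u‖ := fun u =>
      (hM3 u).trans (mul_le_of_le_one_right (norm_nonneg _) (hr u))
    have h1 : ∑ l ∈ s.erase ⟨l₀, hl₀⟩, ‖f (t - l₀ + l)‖ ^ 2 ≤
        ∑ l ∈ s.erase ⟨l₀, hl₀⟩, ‖M (t - l₀ + l)‖ ^ 2 :=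
      Finset.sum_le_sum fun l _ => pow_le_pow_left₀ (norm_nonneg _) (hfM _) 2
    have h2 : ‖f t‖ ^ 2 ≤ ‖M t‖ ^ 2 := pow_le_pow_left₀ (norm_nonneg _) (hfM _) 2
    have h3 : ‖f t‖ ^ 2 ≤ ‖M t‖ ^ 2 * ‖r t‖ ^ 2 := by
      rw [← mul_pow]; exact pow_le_pow_left₀ (norm_nonneg _) (hM3 t) 2
    have h4 : ‖r t‖ ^ 2 ≤ 1 := pow_le_one₀ (norm_nonneg _) (hr t)
    nlinarith
  have h5 := le_of_tendsto (h.2 (t - l₀)) (eventually_atTop.2 ⟨_, key⟩)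
  have h6 : 0 < ‖f t‖ ^ 2 := by positivity
  have h7 : 1 - ‖r t‖ ^ 2 ≤ 0 := by
    by_contra! hc
    have := mul_pos h6 hc
    linarith
  refine le_antisymm (hr t) ?_
  nlinarith [norm_nonneg (r t)]

theorem IsParsevalSet.false_of_factor (h0 : 0 < ρ) (h1 : ρ < 1) (hN : 1 < N)
    (h : IsParsevalSet ρ N Λ) {n : ℕ} (hn : 1 < n) {c : ℝ} (hc : c ≠ 0)
    (hM : ∀ F : Finset ℝ, ↑F ⊆ Λ → ∃ M, IsTrigMean M ∧
      (∀ x ∈ F, ∀ y ∈ F, x ≠ y → M (x - y) = 0) ∧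
      ∀ t, ‖fourierSelfSimilar ρ N t‖ ≤ ‖M t‖ * ‖expMean n (c * t)‖) : False := by
  have hnear : ∀ᶠ t in 𝓝 (0 : ℝ), |c * t| < 1 := by
    have : Continuous fun t : ℝ => |c * t| := by fun_prop
    refine this.continuousAt.eventually_lt continuousAt_const ?_
    simp
  obtain ⟨t, ⟨ht1, ht2⟩, ht3⟩ :=
    ((((fourierSelfSimilar_ne_zero_near h0 h1 (by omega : 0 < N)).and hnear).filter_mono
      (nhdsWithin_le_nhds (s := {0}ᶜ))).and self_mem_nhdsWithin).exists
  have h2 := h.norm_eq_one_of_factor _ (fun t => norm_expMean_le_one n (c * t)) hM ht1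
  refine (norm_expMean_lt_one hn (t := c * t) fun a ha => ?_).ne h2
  rw [ha] at ht2
  have ha0 : a = 0 := by
    have : |a| < 1 := by exact_mod_cast ht2
    exact Int.abs_lt_one_iff.1 this
  rw [ha0, Int.cast_zero, mul_eq_zero] at ha
  exact ha.elim hc ht3

/-- Every level is needed: no Parseval set has all its differences at levels other than `k₀`. -/
theorem IsParsevalSet.exists_level_eq (h0 : 0 < ρ) (h1 : ρ < 1) (hN : 1 < N)
    (h : IsParsevalSet ρ N Λ) {k₀ : ℕ} (hk₀ : 1 ≤ k₀) :
    ∃ x ∈ Λ, ∃ y ∈ Λ, x ≠ y ∧ ∀ k, IsLevel ρ N k (x - y) → k = k₀ := by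
  classical
  by_contra! hcon
  choose! k hk hkne using hcon
  refine h.false_of_factor h0 h1 hN hN (pow_ne_zero k₀ h0.ne') fun F hF => ?_
  set A : Finset ℕ := ((F ×ˢ F).filter fun p => p.1 ≠ p.2).image fun p => k p.1 p.2 with hA
  have hA1 : ∀ m ∈ A, 1 ≤ m ∧ m ≠ k₀ := by
    intro m hm
    simp only [hA, Finset.mem_image, Finset.mem_filter, Finset.mem_product] at hm
    obtain ⟨p, ⟨⟨hp1, hp2⟩, hp3⟩, rfl⟩ := hm
    exact ⟨(hk _ (hF hp1) _ (hF hp2) hp3).1, hkne _ (hF hp1) _ (hF hp2) hp3⟩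
  refine ⟨fun t => ∏ m ∈ A, expMean N (ρ ^ m * t), isTrigMean_prod A _ fun m _ =>
    isTrigMean_expMean (by omega) _, fun x hx y hy hxy => ?_, fun t => ?_⟩
  · refine Finset.prod_eq_zero (i := k x y) ?_ (hk x (hF hx) y (hF hy) hxy).2
    exact Finset.mem_image.2 ⟨(x, y), by simp [hx, hy, hxy], rfl⟩
  · have := norm_fourierSelfSimilar_le_prod h0 h1 (by omega : 0 < N) (insert k₀ A) (by
      intro m hm
      rcases Finset.mem_insert.1 hm with rfl | hm
      exacts [hk₀, (hA1 m hm).1]) t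
    rwa [Finset.prod_insert fun hm => (hA1 _ hm).2 rfl, ← norm_prod, mul_comm] at this

theorem IsParsevalSet.exists_isLevel (h0 : 0 < ρ) (h1 : ρ < 1) (hN : 1 < N)
    (h : IsParsevalSet ρ N Λ) {x y : ℝ} (hx : x ∈ Λ) (hy : y ∈ Λ) (hxy : x ≠ y) :
    ∃ k, IsLevel ρ N k (x - y) :=
  _root_.exists_isLevel h0 h1 (by omega) (h.1 x hx y hy hxy)

/-- Differences of high level occur, and they are large. -/
theorem IsParsevalSet.exists_lt_dist (h0 : 0 < ρ) (h1 : ρ < 1) (hN : 1 < N)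
    (h : IsParsevalSet ρ N Λ) (B : ℝ) : ∃ x ∈ Λ, ∃ y ∈ Λ, x ≠ y ∧ B < |x - y| := by
  obtain ⟨n, hn⟩ := pow_unbounded_of_one_lt (N * B) (one_lt_inv₀ h0 |>.2 h1)
  obtain ⟨x, hx, y, hy, hxy, hk⟩ := h.exists_level_eq h0 h1 hN (k₀ := n + 1) (by omega)
  obtain ⟨k, hk'⟩ := h.exists_isLevel h0 h1 hN hx hy hxy
  refine ⟨x, hx, y, hy, hxy, ?_⟩
  have h2 := hk'.le_abs h0 (by omega)
  rw [hk k hk'] at h2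
  have h3 : ρ⁻¹ ^ n ≤ ρ⁻¹ ^ (n + 1) :=
    pow_le_pow_right₀ (one_lt_inv₀ h0 |>.2 h1).le (Nat.le_succ n)
  have hN0 : (0 : ℝ) < N := by positivity
  exact lt_of_mul_lt_mul_left (hn.trans_le (h3.trans h2)) hN0.le

theorem IsParsevalSet.infinite (h0 : 0 < ρ) (h1 : ρ < 1) (hN : 1 < N)
    (h : IsParsevalSet ρ N Λ) : Λ.Infinite := by
  intro hfin
  obtain ⟨B, hB⟩ := Metric.isBounded_iff.1 hfin.isBounded
  obtain ⟨x, hx, y, hy, -, hlt⟩ := h.exists_lt_dist h0 h1 hN B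
  exact absurd (hB hx hy) (not_le.2 hlt)

/-! ### Integer reciprocal ratio: the digit number divides it -/

/-- For `ρ = 1 / q` and a prime `l` with `v_l(q) < v_l(N) = e`, the primitive `l ^ e`-th roots of
unity are superfluous among the zeros of all factors but the first: a zero of that kind at level
`k + 1` is a zero at level `k`. They are the zeros of a factor which can be split off, namely the
transform of `{0, …, l - 1}` scaled by `l ^ (e - 1)`. -/
theorem IsParsevalSet.dvd_of_inv_nat {q : ℕ} (hq : 1 < q) (hN : 1 < N)
    (h : IsParsevalSet (q : ℝ)⁻¹ N Λ) : N ∣ q := by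
  have hN0 : N ≠ 0 := by omega
  have hq0 : q ≠ 0 := by omega
  have hqR : (q : ℝ) ≠ 0 := by exact_mod_cast hq0
  have h0 : (0 : ℝ) < (q : ℝ)⁻¹ := by positivity
  have h1 : (q : ℝ)⁻¹ < 1 := inv_lt_one_of_one_lt₀ (by exact_mod_cast hq)
  by_contra hdvd
  -- a prime `l` and an exponent with `l ^ (e + 1) ∣ N` but `¬ l ^ (e + 1) ∣ q`
  obtain ⟨l, e, hl, hle, hleq⟩ : ∃ l e : ℕ, l.Prime ∧ l ^ (e + 1) ∣ N ∧ ¬ l ^ (e + 1) ∣ q := by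
    by_contra! hcon
    apply hdvd
    rw [Nat.dvd_iff_prime_pow_dvd_dvd]
    intro p k hp hk
    cases k with
    | zero => simp
    | succ k => exact hcon p k hp hk
  obtain ⟨N', hN'⟩ := hle
  have hl1 := hl.one_lt
  have hN'0 : 0 < N' := Nat.pos_of_ne_zero fun h => hN0 (by simp [hN', h])
  -- `A` is `expMean N` with the factor `expMean l (l ^ e * t)` removed
  set A : ℝ → ℂ := fun t => expMean (l ^ e) t * expMean N' ((l ^ (e + 1) : ℕ) * t) with hA
  have hle0 : 0 < l ^ e := pow_pos hl.pos _
  have hfac : ∀ t, expMean N t = A t * expMean l ((l ^ e : ℕ) * t) := by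
    intro t
    rw [hN', expMean_mul, pow_succ, expMean_mul, hA]
    simp only [pow_succ]
    ring
  have hAt : ∀ c : ℝ, IsTrigMean fun t => A (c * t) := by
    intro c
    have := (isTrigMean_expMean hle0 c).mul (isTrigMean_expMean hN'0 ((l ^ (e + 1) : ℕ) * c))
    simpa only [hA, mul_assoc] using this
  -- a zero not seen by the reduced factor descends one level
  have hdesc : ∀ t : ℝ, expMean N t = 0 → A t ≠ 0 → expMean N (q * t) = 0 := by
    intro t ht hAt0
    rw [hfac, mul_eq_zero, or_iff_right hAt0] at ht
    obtain ⟨a, ha, hla⟩ := (expMean_eq_zero_iff hl.pos _).1 ht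
    have ht' : ((l ^ (e + 1) : ℕ) : ℝ) * t = a := by
      rw [← ha]; push_cast; ring
    rw [expMean_eq_zero_iff (by omega)]
    refine ⟨N' * a * q, ?_, ?_⟩
    · rw [hN']
      push_cast at ht' ⊢
      rw [← ht']
      ring
    · rw [hN']
      push_cast
      intro hd
      have hN'Z : (N' : ℤ) ≠ 0 := by exact_mod_cast hN'0.ne'
      have hd2 : (l : ℤ) ^ (e + 1) ∣ a * q := by
        obtain ⟨w, hw⟩ := hd
        refine ⟨w, mul_left_cancel₀ hN'Z ?_⟩
        linear_combination hw
      have hcop : IsCoprime ((l : ℤ) ^ (e + 1)) a :=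
        ((Nat.prime_iff_prime_int.1 hl).coprime_iff_not_dvd.2 hla).pow_left
      have := hcop.dvd_of_dvd_mul_left hd2
      exact hleq (by exact_mod_cast this)
  refine h.false_of_factor h0 h1 hN hl1
    (c := (l ^ e : ℕ) * ((q : ℝ)⁻¹ ^ 2)) (by positivity) fun F hF => ?_
  classical
  -- a bound for the levels of the differences of elements of `F`
  obtain ⟨n, hn⟩ : ∃ n : ℕ, ∀ x ∈ F, ∀ y ∈ F, x ≠ y →
      ∃ k ≤ n, IsLevel (q : ℝ)⁻¹ N k (x - y) := by
    have hex : ∀ p ∈ F ×ˢ F, ∃ k, p.1 ≠ p.2 → IsLevel (q : ℝ)⁻¹ N k (p.1 - p.2) := by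
      intro p hp
      rw [Finset.mem_product] at hp
      by_cases hpp : p.1 = p.2
      · exact ⟨0, fun hne => absurd hpp hne⟩
      · obtain ⟨k, hk⟩ := h.exists_isLevel h0 h1 hN (hF hp.1) (hF hp.2) hpp
        exact ⟨k, fun _ => hk⟩
    choose! k hk using hex
    refine ⟨(F ×ˢ F).sup k, fun x hx y hy hxy => ⟨k (x, y), ?_, ?_⟩⟩
    · exact Finset.le_sup (Finset.mem_product.2 ⟨hx, hy⟩)
    · exact hk (x, y) (Finset.mem_product.2 ⟨hx, hy⟩) hxy
  -- the first factor is kept and the others are reduced; the part removed from the second factor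
  -- is the one which is split off
  refine ⟨fun t => expMean N ((q : ℝ)⁻¹ ^ 1 * t) *
      ∏ k ∈ Finset.Icc 2 (n + 2), A ((q : ℝ)⁻¹ ^ k * t),
    (isTrigMean_expMean (by omega) _).mul (isTrigMean_prod _ _ fun k _ => hAt _), ?_, ?_⟩
  · intro x hx y hy hxy
    obtain ⟨k, hkn, hk⟩ := hn x hx y hy hxy
    have hrec : ∀ k ≤ n, 1 ≤ k → expMean N ((q : ℝ)⁻¹ ^ k * (x - y)) = 0 →
        expMean N ((q : ℝ)⁻¹ ^ 1 * (x - y)) *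
          ∏ k ∈ Finset.Icc 2 (n + 2), A ((q : ℝ)⁻¹ ^ k * (x - y)) = 0 := by
      intro k
      induction k with
      | zero => intro _ h; omega
      | succ k ih =>
        intro hkn _ hz
        rcases Nat.eq_zero_or_pos k with rfl | hkpos
        · rw [hz, zero_mul]
        · by_cases hAz : A ((q : ℝ)⁻¹ ^ (k + 1) * (x - y)) = 0
          · rw [Finset.prod_eq_zero (i := k + 1) (Finset.mem_Icc.2 ⟨by omega, by omega⟩) hAz,
              mul_zero]
          · refine ih (by omega) hkpos ?_
            rw [← hdesc _ hz hAz, pow_succ]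
            congr 1
            field_simp
    exact hrec k hkn hk.1 hk.2
  · intro t
    have h2 := norm_fourierSelfSimilar_le_prod h0 h1 (by omega : 0 < N) (Finset.Icc 1 (n + 2))
      (fun k hk => (Finset.mem_Icc.1 hk).1) t
    refine h2.trans ?_
    have hI : Finset.Icc 1 (n + 2) = insert 1 (insert 2 (Finset.Icc 3 (n + 2))) := by
      ext k; simp only [Finset.mem_Icc, Finset.mem_insert]; omega
    have hI2 : Finset.Icc 2 (n + 2) = insert 2 (Finset.Icc 3 (n + 2)) := by
      ext k; simp only [Finset.mem_Icc, Finset.mem_insert]; omega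
    beta_reduce
    rw [hI, hI2, Finset.prod_insert (by simp), Finset.prod_insert (by simp),
      Finset.prod_insert (by simp), norm_mul, norm_mul, norm_prod]
    have h3 : ∏ k ∈ Finset.Icc 3 (n + 2), ‖expMean N ((q : ℝ)⁻¹ ^ k * t)‖ ≤
        ∏ k ∈ Finset.Icc 3 (n + 2), ‖A ((q : ℝ)⁻¹ ^ k * t)‖ := by
      refine Finset.prod_le_prod (fun _ _ => norm_nonneg _) fun k _ => ?_
      rw [hfac, norm_mul]
      exact mul_le_of_le_one_right (norm_nonneg _) (norm_expMean_le_one _ _)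
    rw [hfac ((q : ℝ)⁻¹ ^ 2 * t), norm_mul, ← mul_assoc ((l ^ e : ℕ) : ℝ)]
    calc _ ≤ ‖expMean N ((q : ℝ)⁻¹ ^ 1 * t)‖ * (‖A ((q : ℝ)⁻¹ ^ 2 * t)‖ *
          ‖expMean l (((l ^ e : ℕ) : ℝ) * (q : ℝ)⁻¹ ^ 2 * t)‖ *
          ∏ k ∈ Finset.Icc 3 (n + 2), ‖A ((q : ℝ)⁻¹ ^ k * t)‖) := by gcongr
      _ = _ := by ring

end

/-! ### Levels do not tend to infinity -/

section
variable {K : Type*} [Field K] {θ : K} {N : ℕ} {x : ℕ → K} {k : ℕ → ℕ → ℕ}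
  {a : ℕ → ℕ → ℤ}

theorem hyperfilter_eventually_ne (i : ℕ) : ∀ᶠ j in (hyperfilter ℕ : Filter ℕ), i ≠ j := by
  have : Filter.Tendsto id (hyperfilter ℕ : Filter ℕ) atTop := Nat.hyperfilter_le_atTop
  filter_upwards [this.eventually_gt_atTop i] with j hj
  exact (show i < j from hj).ne

/-- For an embedding into `PadicAlgCl l`, with the coefficients uniformly bounded away from `0`
`l`-adically, the base has norm `> 1`: if the norm is `< 1`, the sequence converges to each of its
terms, and if it is `1`, the sequence is bounded in a finite extension of `ℚ_[l]` but uniformly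
separated. -/
theorem one_lt_norm_of_levels {l : ℕ} [Fact l.Prime] (σ : K →+* PadicAlgCl l) (hθ : θ ≠ 0)
    (hx : ∀ i j, i ≠ j → x j - x i = θ ^ k i j * a i j) (ha : ∀ i j, i ≠ j → a i j ≠ 0)
    (hk : ∀ i, Tendsto (k i) (hyperfilter ℕ) atTop) {δ : ℝ} (hδ : 0 < δ)
    (hI : ∀ᶠ i in (hyperfilter ℕ : Filter ℕ), ∀ᶠ j in (hyperfilter ℕ : Filter ℕ),
      δ ≤ ‖(a i j : PadicAlgCl l)‖) : 1 < ‖σ θ‖ := by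
  have hz : ∀ i j, i ≠ j → σ (x j) - σ (x i) = σ θ ^ k i j * a i j := by
    intro i j hij
    rw [← map_sub, hx i j hij]
    simp
  have hale : ∀ b : ℤ, ‖(b : PadicAlgCl l)‖ ≤ 1 := by
    intro b
    have : (b : PadicAlgCl l) = algebraMap ℚ_[l] (PadicAlgCl l) b := by simp
    rw [this, norm_algebraMap']
    exact Padic.norm_int_le_one b
  rcases lt_trichotomy ‖σ θ‖ 1 with hlt | heq | hgt
  · exfalso
    have hlim : ∀ i, Tendsto (fun j => σ (x j)) (hyperfilter ℕ) (𝓝 (σ (x i))) := by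
      intro i
      rw [tendsto_iff_norm_sub_tendsto_zero]
      have h1 : Tendsto (fun j => ‖σ θ‖ ^ k i j) (hyperfilter ℕ) (𝓝 0) :=
        (tendsto_pow_atTop_nhds_zero_of_lt_one (norm_nonneg _) hlt).comp (hk i)
      refine squeeze_zero' (Eventually.of_forall fun _ => norm_nonneg _) ?_ h1
      filter_upwards [hyperfilter_eventually_ne i] with j hj
      rw [hz i j hj, norm_mul, norm_pow]
      exact mul_le_of_le_one_right (by positivity) (hale _)
    have h2 : σ (x 0) = σ (x 1) := tendsto_nhds_unique (hlim 0) (hlim 1)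
    have h3 := hz 0 1 (by omega)
    rw [h2, sub_self, eq_comm, mul_eq_zero] at h3
    rcases h3 with h3 | h3
    · exact pow_ne_zero _ ((map_ne_zero σ).2 hθ) h3
    · exact ha 0 1 (by omega) (by exact_mod_cast h3)
  -- the differences lie in a closed ball of the finite extension `ℚ_[l](σ θ)`, which is compact
  · exfalso
    obtain ⟨c, hc⟩ : ∃ c, Tendsto (fun j => σ (x j)) (hyperfilter ℕ) (𝓝 c) := by
      set S : Submodule ℚ_[l] (PadicAlgCl l) :=
        (IntermediateField.adjoin ℚ_[l] {σ θ}).toSubalgebra.toSubmodule with hS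
      have hfin : FiniteDimensional ℚ_[l] S :=
        IntermediateField.adjoin.finiteDimensional (Algebra.IsIntegral.isIntegral _)
      have hprop : ProperSpace S := FiniteDimensional.proper ℚ_[l] S
      have hmem : ∀ j, σ (x j) - σ (x 0) ∈ S := by
        intro j
        by_cases hj : 0 = j
        · rw [← hj, sub_self]; exact S.zero_mem
        · rw [hz 0 j hj]
          change _ ∈ IntermediateField.adjoin ℚ_[l] {σ θ}
          exact mul_mem (pow_mem (IntermediateField.mem_adjoin_simple_self _ _) _)
            (intCast_mem _ _)
      let w : ℕ → S := fun j => ⟨σ (x j) - σ (x 0), hmem j⟩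
      have hw : ∀ j, w j ∈ Metric.closedBall (0 : S) 1 := by
        intro j
        rw [mem_closedBall_zero_iff]
        change ‖σ (x j) - σ (x 0)‖ ≤ 1
        by_cases hj : 0 = j
        · rw [← hj, sub_self, norm_zero]; exact zero_le_one
        · rw [hz 0 j hj, norm_mul, norm_pow, heq, one_pow, one_mul]
          exact hale _
      obtain ⟨c, -, hc⟩ := (isCompact_closedBall (0 : S) 1).ultrafilter_le_nhds
        ((hyperfilter ℕ).map w) (by
          rw [le_principal_iff]
          exact Filter.Eventually.of_forall (f := (hyperfilter ℕ : Filter ℕ)) hw)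
      have hc' : Tendsto w (hyperfilter ℕ) (𝓝 c) := hc
      have h4 := ((continuous_subtype_val.tendsto c).comp hc').add_const (σ (x 0))
      refine ⟨_, h4.congr fun j => ?_⟩
      simp [w]
    have hsep : ∀ᶠ i in (hyperfilter ℕ : Filter ℕ), δ ≤ ‖c - σ (x i)‖ := by
      filter_upwards [hI] with i hi
      refine ge_of_tendsto (hc.sub_const (σ (x i))).norm ?_
      filter_upwards [hi, hyperfilter_eventually_ne i] with j hj hij
      rwa [hz i j hij, norm_mul, norm_pow, heq, one_pow, one_mul]
    have h5 : Tendsto (fun i => ‖c - σ (x i)‖) (hyperfilter ℕ) (𝓝 0) := by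
      have := (tendsto_const_nhds (x := c)).sub hc
      simpa using this.norm
    exact absurd (ge_of_tendsto h5 hsep) (not_le.2 hδ)
  · exact hgt

/-- Pairs of integers not divisible by `N`, one for each pair of indices: along an ultrafilter
one prime power divisor of `N` is responsible for all of them. -/
theorem exists_prime_pow_not_dvd (hN : 0 < N) (ha : ∀ i j, i ≠ j → ¬ (N : ℤ) ∣ a i j) :
    ∃ l e : ℕ, l.Prime ∧ ∀ᶠ i in (hyperfilter ℕ : Filter ℕ),
      ∀ᶠ j in (hyperfilter ℕ : Filter ℕ), ¬ ((l ^ e : ℕ) : ℤ) ∣ a i j := by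
  have hprime : ∀ b : ℤ, ¬ (N : ℤ) ∣ b → ∃ l ∈ N.primeFactors,
      ¬ ((l ^ N.factorization l : ℕ) : ℤ) ∣ b := by
    intro b hb
    by_contra! hcon
    apply hb
    rw [Int.natCast_dvd]
    refine (Nat.dvd_iff_prime_pow_dvd_dvd _ _).2 fun p m hp hm => ?_
    cases m with
    | zero => simp
    | succ m =>
      have hpN : p ∈ N.primeFactors :=
        Nat.mem_primeFactors.2 ⟨hp, (dvd_pow_self p (Nat.succ_ne_zero m)).trans hm, hN.ne'⟩
      exact (pow_dvd_pow p ((hp.pow_dvd_iff_le_factorization hN.ne').1 hm)).trans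
        (Int.natCast_dvd.1 (hcon p hpN))
  have hfin : ∀ (Q : ℕ → ℕ → Prop), (∀ᶠ j in (hyperfilter ℕ : Filter ℕ),
      ∃ l ∈ N.primeFactors, Q l j) → ∃ l ∈ N.primeFactors, ∀ᶠ j in (hyperfilter ℕ : Filter ℕ),
        Q l j := by
    intro Q hQ
    have := (Ultrafilter.finite_biUnion_mem_iff (f := hyperfilter ℕ)
      (is := (N.primeFactors : Set ℕ)) (s := fun l => {j | Q l j}) (Finset.finite_toSet _)).1 (by
        filter_upwards [hQ] with j hj
        simpa using hj)
    exact this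
  have h1 : ∀ i, ∃ l ∈ N.primeFactors, ∀ᶠ j in (hyperfilter ℕ : Filter ℕ),
      ¬ ((l ^ N.factorization l : ℕ) : ℤ) ∣ a i j := fun i => hfin _ (by
    filter_upwards [hyperfilter_eventually_ne i] with j hj
    exact hprime _ (ha i j hj))
  obtain ⟨l, hl, hl'⟩ := hfin _ (Eventually.of_forall h1)
  exact ⟨l, _, (Nat.mem_primeFactors.1 hl).1, hl'⟩

/-- If the levels of `x j - x i` tend to infinity with `j` for each `i`, then some two indices
`i₀, i₁` have a constant difference `u` of levels along the ultrafilter, and `θ ^ u` is rational: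
for each embedding of the field into `PadicAlgCl l`, the image of `θ ^ u` is the limit of
`a i₀ j / a i₁ j`, which does not depend on the embedding. -/
theorem exists_zpow_eq_ratCast_of_levels [Algebra ℚ K] [Algebra.IsAlgebraic ℚ K]
    (hN : 0 < N) (hθ : θ ≠ 0)
    (hx : ∀ i j, i ≠ j → x j - x i = θ ^ k i j * a i j) (ha : ∀ i j, i ≠ j → ¬ (N : ℤ) ∣ a i j)
    (hk : ∀ i, Tendsto (k i) (hyperfilter ℕ) atTop) :
    ∃ i₀ i₁ : ℕ, i₀ ≠ i₁ ∧ ∃ (u : ℤ) (s : ℚ), θ ^ u = s ∧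
      ∀ᶠ j in (hyperfilter ℕ : Filter ℕ), (k i₁ j : ℤ) = k i₀ j + u := by
  obtain ⟨l, e, hl, hI⟩ := exists_prime_pow_not_dvd hN ha
  have : Fact l.Prime := ⟨hl⟩
  have hna : ∀ b : ℤ, ‖(b : PadicAlgCl l)‖ = ‖(b : ℚ_[l])‖ := by
    intro b
    have : (b : PadicAlgCl l) = algebraMap ℚ_[l] (PadicAlgCl l) b := by simp
    rw [this, norm_algebraMap']
  set δ : ℝ := (l : ℝ) ^ (-(e : ℤ)) with hδdef
  have hδ : 0 < δ := zpow_pos (by exact_mod_cast hl.pos) _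
  have hI' : ∀ᶠ i in (hyperfilter ℕ : Filter ℕ), ∀ᶠ j in (hyperfilter ℕ : Filter ℕ),
      δ ≤ ‖(a i j : PadicAlgCl l)‖ := by
    filter_upwards [hI] with i hi
    filter_upwards [hi] with j hj
    rw [hna]
    refine (not_le.1 fun hle => hj ?_).le
    have := (Padic.norm_int_le_pow_iff_dvd (p := l) (a i j) e).1 hle
    exact_mod_cast this
  have ha0 : ∀ i j, i ≠ j → a i j ≠ 0 := fun i j hij h0 => ha i j hij (h0 ▸ dvd_zero _)
  have hbig : ∀ σ : K →+* PadicAlgCl l, 1 < ‖σ θ‖ := fun σ =>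
    one_lt_norm_of_levels σ hθ hx ha0 hk hδ hI'
  obtain ⟨i₀, hi₀⟩ := hI'.exists
  obtain ⟨i₁, hi₁, hi01⟩ := (hI'.and (hyperfilter_eventually_ne i₀)).exists
  have hz : ∀ (σ : K →+* PadicAlgCl l) (i j : ℕ), i ≠ j →
      σ (x j) - σ (x i) = σ θ ^ k i j * a i j := by
    intro σ i j hij
    rw [← map_sub, hx i j hij]
    simp
  have hale : ∀ b : ℤ, ‖(b : PadicAlgCl l)‖ ≤ 1 := fun b => by
    rw [hna]; exact Padic.norm_int_le_one b
  -- the level difference is bounded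
  let σ₀ : K →ₐ[ℚ] PadicAlgCl l := IsAlgClosed.lift
  obtain ⟨B, hB⟩ : ∃ B : ℕ, 1 < δ * ‖σ₀ θ‖ ^ B := by
    obtain ⟨B, hB⟩ := pow_unbounded_of_one_lt δ⁻¹ (hbig σ₀)
    refine ⟨B, ?_⟩
    rwa [inv_lt_iff_one_lt_mul₀' hδ] at hB
  have htends : ∀ (σ : K →+* PadicAlgCl l) i, Tendsto (fun j => ‖σ θ‖ ^ k i j) (hyperfilter ℕ)
      atTop := fun σ i => (tendsto_pow_atTop_atTop_of_one_lt (hbig σ)).comp (hk i)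
  have hbdd : ∀ᶠ j in (hyperfilter ℕ : Filter ℕ),
      (k i₁ j : ℤ) - k i₀ j ∈ Set.Icc (-(B : ℤ)) B := by
    have hlarge := ((htends σ₀ i₀).const_mul_atTop hδ).eventually_gt_atTop ‖σ₀ (x i₁) - σ₀ (x i₀)‖
    filter_upwards [hi₀, hi₁, hlarge, hyperfilter_eventually_ne i₀, hyperfilter_eventually_ne i₁]
      with j h0 h1 h2 hj0 hj1
    have e0 : ‖σ₀ (x j) - σ₀ (x i₀)‖ = ‖σ₀ θ‖ ^ k i₀ j * ‖(a i₀ j : PadicAlgCl l)‖ := by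
      have := hz σ₀ i₀ j hj0
      simp only [RingHom.coe_coe] at this
      rw [this, norm_mul, norm_pow]
    have e1 : ‖σ₀ (x j) - σ₀ (x i₁)‖ = ‖σ₀ θ‖ ^ k i₁ j * ‖(a i₁ j : PadicAlgCl l)‖ := by
      have := hz σ₀ i₁ j hj1
      simp only [RingHom.coe_coe] at this
      rw [this, norm_mul, norm_pow]
    have hgt : ‖σ₀ (x i₁) - σ₀ (x i₀)‖ < ‖σ₀ (x j) - σ₀ (x i₀)‖ := by
      refine h2.trans_le ?_
      rw [e0, mul_comm]
      exact mul_le_mul_of_nonneg_left h0 (by positivity)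
    have heq : ‖σ₀ (x j) - σ₀ (x i₁)‖ = ‖σ₀ (x j) - σ₀ (x i₀)‖ := by
      have h3 : (σ₀ (x j) - σ₀ (x i₁)) + -(σ₀ (x j) - σ₀ (x i₀)) = -(σ₀ (x i₁) - σ₀ (x i₀)) := by
        ring
      rw [← norm_neg (σ₀ (x j) - σ₀ (x i₀))]
      refine IsUltrametricDist.norm_eq_of_add_norm_lt_max ?_
      rw [h3, norm_neg, norm_neg]
      exact hgt.trans_le (le_max_right _ _)
    rw [e0, e1] at heq
    have hτ : 1 < ‖σ₀ θ‖ := hbig σ₀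
    have hpos : ∀ n : ℕ, 0 < ‖σ₀ θ‖ ^ n := fun n => by positivity
    constructor
    · by_contra! hlt
      have hle : k i₁ j + B ≤ k i₀ j := by omega
      have h4 : ‖σ₀ θ‖ ^ (k i₁ j) * ‖σ₀ θ‖ ^ B ≤ ‖σ₀ θ‖ ^ k i₀ j := by
        rw [← pow_add]; exact pow_le_pow_right₀ hτ.le hle
      have h5 : ‖σ₀ θ‖ ^ k i₁ j * ‖(a i₁ j : PadicAlgCl l)‖ ≤ ‖σ₀ θ‖ ^ k i₁ j :=
        mul_le_of_le_one_right (hpos _).le (hale _)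
      have h6 : ‖σ₀ θ‖ ^ k i₀ j * δ ≤ ‖σ₀ θ‖ ^ k i₀ j * ‖(a i₀ j : PadicAlgCl l)‖ := by gcongr
      have h7 : ‖σ₀ θ‖ ^ k i₁ j * 1 < ‖σ₀ θ‖ ^ k i₁ j * (δ * ‖σ₀ θ‖ ^ B) :=
        mul_lt_mul_of_pos_left hB (hpos _)
      have h8 := mul_le_mul_of_nonneg_right h4 hδ.le
      linarith
    · by_contra! hlt
      have hle : k i₀ j + B ≤ k i₁ j := by omega
      have h4 : ‖σ₀ θ‖ ^ (k i₀ j) * ‖σ₀ θ‖ ^ B ≤ ‖σ₀ θ‖ ^ k i₁ j := by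
        rw [← pow_add]; exact pow_le_pow_right₀ hτ.le hle
      have h5 : ‖σ₀ θ‖ ^ k i₀ j * ‖(a i₀ j : PadicAlgCl l)‖ ≤ ‖σ₀ θ‖ ^ k i₀ j :=
        mul_le_of_le_one_right (hpos _).le (hale _)
      have h6 : ‖σ₀ θ‖ ^ k i₁ j * δ ≤ ‖σ₀ θ‖ ^ k i₁ j * ‖(a i₁ j : PadicAlgCl l)‖ := by gcongr
      have h7 : ‖σ₀ θ‖ ^ k i₀ j * 1 < ‖σ₀ θ‖ ^ k i₀ j * (δ * ‖σ₀ θ‖ ^ B) :=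
        mul_lt_mul_of_pos_left hB (hpos _)
      have h8 := mul_le_mul_of_nonneg_right h4 hδ.le
      linarith
  obtain ⟨u, hu⟩ : ∃ u : ℤ, ∀ᶠ j in (hyperfilter ℕ : Filter ℕ), (k i₁ j : ℤ) = k i₀ j + u := by
    have := (Ultrafilter.finite_biUnion_mem_iff (f := hyperfilter ℕ)
      (is := Set.Icc (-(B : ℤ)) B) (s := fun u => {j | (k i₁ j : ℤ) = k i₀ j + u})
      (Set.finite_Icc _ _)).1 (by
        filter_upwards [hbdd] with j hj
        simp only [Set.mem_iUnion]
        exact ⟨_, hj, by simp⟩)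
    obtain ⟨u, -, hu⟩ := this
    exact ⟨u, hu⟩
  refine ⟨i₀, i₁, hi01, u, ?_⟩
  -- the image of `θ ^ u` under every embedding is the same limit
  have hlim : ∀ σ : K →+* PadicAlgCl l, Tendsto
      (fun j => (a i₀ j : PadicAlgCl l) / a i₁ j) (hyperfilter ℕ) (𝓝 (σ (θ ^ u))) := by
    intro σ
    rw [tendsto_iff_norm_sub_tendsto_zero]
    have h1 : Tendsto (fun j => ‖σ (x i₁) - σ (x i₀)‖ / δ * (‖σ θ‖ ^ k i₀ j)⁻¹) (hyperfilter ℕ)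
        (𝓝 0) := by
      simpa using (htends σ i₀).inv_tendsto_atTop.const_mul (‖σ (x i₁) - σ (x i₀)‖ / δ)
    refine squeeze_zero' (Eventually.of_forall fun _ => norm_nonneg _) ?_ h1
    filter_upwards [hi₁, hu, hyperfilter_eventually_ne i₀, hyperfilter_eventually_ne i₁]
      with j h2 huj hj0 hj1
    have hσθ : σ θ ≠ 0 := (map_ne_zero σ).2 hθ
    have hane : (a i₁ j : PadicAlgCl l) ≠ 0 := by exact_mod_cast ha0 i₁ j hj1
    have h3 : σ θ ^ k i₁ j = σ θ ^ k i₀ j * σ (θ ^ u) := by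
      rw [map_zpow₀, ← zpow_natCast, huj, zpow_add₀ hσθ, zpow_natCast]
    have h4 : (a i₀ j : PadicAlgCl l) / a i₁ j - σ (θ ^ u) =
        (σ (x i₁) - σ (x i₀)) / (σ θ ^ k i₀ j * a i₁ j) := by
      have e0 := hz σ i₀ j hj0
      have e1 := hz σ i₁ j hj1
      rw [h3] at e1
      rw [div_sub' hane, div_eq_div_iff hane (mul_ne_zero (pow_ne_zero _ hσθ) hane)]
      linear_combination (a i₁ j : PadicAlgCl l) * (e1 - e0)
    rw [h4, norm_div, norm_mul, norm_pow, div_mul_eq_mul_div, div_eq_mul_inv, mul_inv]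
    have h5 : ‖(a i₁ j : PadicAlgCl l)‖⁻¹ ≤ δ⁻¹ := inv_anti₀ hδ h2
    calc _ ≤ ‖σ (x i₁) - σ (x i₀)‖ * ((‖σ θ‖ ^ k i₀ j)⁻¹ * δ⁻¹) := by gcongr
      _ = _ := by ring
  have hconst : ∀ σ : K →ₐ[ℚ] PadicAlgCl l, σ (θ ^ u) = σ₀ (θ ^ u) := fun σ =>
    tendsto_nhds_unique (hlim σ) (hlim σ₀)
  -- so the minimal polynomial of `θ ^ u` has only one root
  have hint : IsIntegral ℚ (θ ^ u) := Algebra.IsIntegral.isIntegral _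
  have hroots : (minpoly ℚ (θ ^ u)).rootSet (PadicAlgCl l) ⊆ {σ₀ (θ ^ u)} := by
    rw [← Algebra.IsAlgebraic.range_eval_eq_rootSet_minpoly]
    rintro _ ⟨σ, rfl⟩
    exact hconst σ
  have hcard := Polynomial.card_rootSet_eq_natDegree (K := PadicAlgCl l)
    (minpoly.irreducible hint).separable (IsAlgClosed.splits _)
  have hdeg : (minpoly ℚ (θ ^ u)).natDegree ≤ 1 := by
    rw [← hcard, Fintype.card_eq_nat_card, Nat.card_coe_set_eq]
    exact (Set.ncard_le_ncard hroots).trans (Set.ncard_singleton _).le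
  have hdeg1 : (minpoly ℚ (θ ^ u)).degree = 1 := by
    rw [Polynomial.degree_eq_natDegree (minpoly.ne_zero hint)]
    have := minpoly.natDegree_pos hint
    norm_cast
    omega
  obtain ⟨s, hs⟩ := minpoly.mem_range_of_degree_eq_one ℚ _ hdeg1
  exact ⟨s, by rw [← hs, eq_ratCast], hu⟩

end

/-- No sequence of reals has differences `x j - x i = θ ^ (k i j) * a i j` with integers `a i j` not
divisible by `N` and levels `k i j` tending to infinity with `j` for each `i`. -/
theorem levels_not_tendsto {θ : ℝ} (hθ : 1 < θ) {N : ℕ} (hN : 0 < N) (x : ℕ → ℝ) (k : ℕ → ℕ → ℕ)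
    (a : ℕ → ℕ → ℤ) (hx : ∀ i j, i ≠ j → x j - x i = θ ^ k i j * a i j)
    (ha : ∀ i j, i ≠ j → ¬ (N : ℤ) ∣ a i j)
    (hk : ∀ i, Tendsto (k i) (hyperfilter ℕ) atTop) : False := by
  have hθ0 : θ ≠ 0 := by positivity
  have ha0 : ∀ i j, i ≠ j → a i j ≠ 0 := fun i j hij h0 => ha i j hij (h0 ▸ dvd_zero _)
  -- `θ` is algebraic, by the relation between three differences
  have halg : IsIntegral ℚ θ := by
    obtain ⟨j, hj0, hj1, hj2, hj3⟩ := ((hyperfilter_eventually_ne 0).and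
      ((hyperfilter_eventually_ne 1).and (((hk 0).eventually_gt_atTop (k 0 1)).and
        ((hk 1).eventually_gt_atTop (k 0 1))))).exists
    have h1 := hx 0 j hj0
    have h2 := hx 1 j hj1
    have h3 := hx 0 1 (by omega)
    set p : Polynomial ℚ := Polynomial.C (a 0 j : ℚ) * Polynomial.X ^ k 0 j -
      Polynomial.C (a 1 j : ℚ) * Polynomial.X ^ k 1 j -
      Polynomial.C (a 0 1 : ℚ) * Polynomial.X ^ k 0 1 with hp
    have hp0 : p ≠ 0 := by
      intro h0
      have hc := congrArg (fun q => Polynomial.coeff q (k 0 1)) h0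
      simp only [hp, Polynomial.coeff_sub, Polynomial.coeff_C_mul_X_pow, hj2.ne, hj3.ne,
        if_false, if_true, Polynomial.coeff_zero] at hc
      have := ha0 0 1 (by omega)
      apply this
      have h4 : (a 0 1 : ℚ) = 0 := by linarith
      exact_mod_cast h4
    rw [← isAlgebraic_iff_isIntegral]
    refine ⟨p, hp0, ?_⟩
    simp only [hp, map_sub, map_mul, Polynomial.aeval_C, map_pow, Polynomial.aeval_X, eq_ratCast,
      Rat.cast_intCast]
    linear_combination h2 + h3 - h1
  let K := IntermediateField.adjoin ℚ {θ}
  let t : K := IntermediateField.AdjoinSimple.gen ℚ θ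
  have ht : (t : ℝ) = θ := IntermediateField.AdjoinSimple.coe_gen ℚ θ
  have : FiniteDimensional ℚ K := IntermediateField.adjoin.finiteDimensional halg
  let y : ℕ → K := fun j => if 0 = j then 0 else t ^ k 0 j * a 0 j
  have hy : ∀ j, (y j : ℝ) = x j - x 0 := by
    intro j
    by_cases hj : 0 = j
    · simp [y, ← hj]
    · simp only [y, hj, if_false, hx 0 j hj]
      push_cast
      rw [ht]
  have hyx : ∀ i j, i ≠ j → y j - y i = t ^ k i j * a i j := by
    intro i j hij
    apply Subtype.ext
    push_cast
    rw [hy, hy, ht, ← hx i j hij]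
    ring
  have ht0 : t ≠ 0 := fun h => hθ0 (by rw [← ht, h]; rfl)
  obtain ⟨i₀, i₁, hi, u, s, hs, hu⟩ := exists_zpow_eq_ratCast_of_levels hN ht0 hyx ha hk
  have hsR : θ ^ u = s := by
    have := congrArg (fun z : K => (z : ℝ)) hs
    have h5 : ((t ^ u : K) : ℝ) = (t : ℝ) ^ u := map_zpow₀ (algebraMap K ℝ) t u
    rw [← ht, ← h5, this]
    rfl
  -- an integer sequence tending to zero in the reals
  have hlim : Tendsto (fun j => s.den * (x i₁ - x i₀) * (θ ^ k i₀ j)⁻¹) (hyperfilter ℕ) (𝓝 0) := by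
    simpa using ((tendsto_pow_atTop_atTop_of_one_lt hθ).comp (hk i₀)).inv_tendsto_atTop.const_mul
      (s.den * (x i₁ - x i₀))
  have hsmall := hlim.norm.eventually (eventually_lt_nhds (a := ‖(0 : ℝ)‖) (b := 1) (by simp))
  obtain ⟨j, hj, huj, hj0, hj1⟩ := (hsmall.and (hu.and ((hyperfilter_eventually_ne i₀).and
    (hyperfilter_eventually_ne i₁)))).exists
  have hpow : θ ^ k i₀ j ≠ 0 := pow_ne_zero _ hθ0
  have h3 : θ ^ k i₁ j = θ ^ k i₀ j * s := by
    rw [← hsR, ← zpow_natCast, huj, zpow_add₀ hθ0, zpow_natCast]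
  have hden : (s.den : ℝ) ≠ 0 := by exact_mod_cast s.den_nz
  have hsd : (s : ℝ) * s.den = s.num := by exact_mod_cast Rat.mul_den_eq_num s
  have e0 := hx i₀ j hj0
  have e1 := hx i₁ j hj1
  rw [h3] at e1
  have h4 : s.den * (x i₁ - x i₀) * (θ ^ k i₀ j)⁻¹ =
      ((s.den * a i₀ j - s.num * a i₁ j : ℤ) : ℝ) := by
    rw [← div_eq_mul_inv, div_eq_iff hpow]
    push_cast
    linear_combination (s.den : ℝ) * (e0 - e1) - θ ^ k i₀ j * a i₁ j * hsd
  rw [h4, Real.norm_eq_abs] at hj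
  have h5 : s.den * a i₀ j - s.num * a i₁ j = 0 := Int.abs_lt_one_iff.1 (by exact_mod_cast hj)
  rw [h5, Int.cast_zero, mul_eq_zero, or_iff_left (inv_ne_zero hpow), mul_eq_zero,
    or_iff_right hden, hx i₀ i₁ hi, mul_eq_zero, or_iff_right (pow_ne_zero _ hθ0)] at h4
  exact ha0 i₀ i₁ hi (by exact_mod_cast h4)

/-! ### The contraction ratio of a spectral measure is rational -/

theorem exists_eventually_eq_of_finite {α : Type*} {s : Set α} (hs : s.Finite) {g : ℕ → α}
    (hg : ∀ᶠ j in (hyperfilter ℕ : Filter ℕ), g j ∈ s) :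
    ∃ c ∈ s, ∀ᶠ j in (hyperfilter ℕ : Filter ℕ), g j = c := by
  refine (Ultrafilter.finite_biUnion_mem_iff (f := hyperfilter ℕ) (is := s)
    (s := fun c => {j | g j = c}) hs).1 ?_
  filter_upwards [hg] with j hj
  simpa using hj

theorem exists_pow_eq_ratCast {θ : ℝ} (hθ : 0 < θ) {m n : ℕ} (hmn : m ≠ n) {a b : ℤ} (ha : a ≠ 0)
    (h : θ ^ m * a = θ ^ n * b) : ∃ r : ℕ, 1 ≤ r ∧ ∃ s : ℚ, θ ^ r = s := by
  wlog hlt : m < n generalizing m n a b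
  · have hb : b ≠ 0 := by
      rintro rfl
      rw [Int.cast_zero, mul_zero, mul_eq_zero] at h
      rcases h with h | h
      · exact pow_ne_zero _ hθ.ne' h
      · exact ha (by exact_mod_cast h)
    exact this hmn.symm hb h.symm (by omega)
  have hb : (b : ℝ) ≠ 0 := by
    intro hb
    rw [hb, mul_zero, mul_eq_zero] at h
    rcases h with h | h
    · exact pow_ne_zero _ hθ.ne' h
    · exact ha (by exact_mod_cast h)
  refine ⟨n - m, by omega, a / b, ?_⟩
  push_cast
  rw [eq_div_iff hb]
  apply mul_left_cancel₀ (pow_ne_zero m hθ.ne')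
  rw [h, ← mul_assoc, ← pow_add, Nat.add_sub_cancel' hlt.le]

section
variable {ρ : ℝ} {N : ℕ} {Λ : Set ℝ}

/-- Some level occurs infinitely often among the differences from a fixed frequency; two of these
have coefficients congruent mod `N`, so that their difference has a second level. -/
theorem IsParsevalSet.exists_pow_eq_ratCast (h0 : 0 < ρ) (h1 : ρ < 1) (hN : 1 < N)
    (h : IsParsevalSet ρ N Λ) : ∃ r : ℕ, 1 ≤ r ∧ ∃ s : ℚ, ρ⁻¹ ^ r = s := by
  have hN0 : 0 < N := by omega
  have hθ : 1 < ρ⁻¹ := one_lt_inv₀ h0 |>.2 h1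
  have hθ0 : 0 < ρ⁻¹ := by positivity
  let f := (h.infinite h0 h1 hN).natEmbedding
  have hf : ∀ i j, i ≠ j → (f i : ℝ) ≠ f j := fun i j hij he =>
    hij (f.injective (Subtype.ext he))
  have hex : ∀ i j, ∃ (k : ℕ) (a : ℤ), i ≠ j →
      (N : ℝ) * f j - N * f i = ρ⁻¹ ^ k * a ∧ ¬ (N : ℤ) ∣ a := by
    intro i j
    by_cases hij : i = j
    · exact ⟨0, 0, fun hne => absurd hij hne⟩
    · obtain ⟨k, hk⟩ := h.exists_isLevel h0 h1 hN (f j).2 (f i).2 (hf j i (Ne.symm hij))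
      obtain ⟨-, a, ha, hna⟩ := (isLevel_iff h0 hN0).1 hk
      exact ⟨k, a, fun _ => ⟨by rw [← ha]; ring, hna⟩⟩
  choose k a hka using hex
  have hnot : ¬ ∀ i, Tendsto (k i) (hyperfilter ℕ) atTop := fun hk =>
    levels_not_tendsto hθ hN0 (fun j => N * f j) k a (fun i j hij => (hka i j hij).1)
      (fun i j hij => (hka i j hij).2) hk
  push Not at hnot
  obtain ⟨i, hi⟩ := hnot
  rw [tendsto_atTop] at hi
  push Not at hi
  obtain ⟨B, hB⟩ := hi
  have hB' : ∀ᶠ j in (hyperfilter ℕ : Filter ℕ), k i j ∈ Set.Iio B := by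
    exact hB
  obtain ⟨κ, -, hκ⟩ := exists_eventually_eq_of_finite (Set.finite_Iio B) hB'
  have : NeZero N := ⟨hN0.ne'⟩
  obtain ⟨c, -, hc⟩ := exists_eventually_eq_of_finite (Set.finite_univ (α := ZMod N))
    (g := fun j => (a i j : ZMod N)) (Eventually.of_forall fun _ => Set.mem_univ _)
  -- two indices with the same level `κ` and congruent coefficients; the level of their difference is
  -- another one, since `N` divides the coefficient at `κ` but not the one at its level
  have hall := (hκ.and hc).and (hyperfilter_eventually_ne i)
  obtain ⟨j, ⟨hj1, hj2⟩, hij⟩ := hall.exists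
  obtain ⟨j', ⟨⟨hj1', hj2'⟩, hij'⟩, hjj⟩ := (hall.and (hyperfilter_eventually_ne j)).exists
  have e1 := (hka i j hij).1
  have e2 := (hka i j' hij').1
  obtain ⟨e3, hnd⟩ := hka j j' hjj
  rw [hj1] at e1
  rw [hj1'] at e2
  have hdvd : (N : ℤ) ∣ a i j' - a i j := by
    rw [← ZMod.intCast_zmod_eq_zero_iff_dvd]
    push_cast
    rw [hj2, hj2', sub_self]
  have e4 : ρ⁻¹ ^ k j j' * (a j j' : ℝ) = ρ⁻¹ ^ κ * ((a i j' - a i j : ℤ) : ℝ) := by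
    rw [← e3]; push_cast; linear_combination e2 - e1
  have ha0 : a j j' ≠ 0 := fun h0 => hnd (h0 ▸ dvd_zero _)
  refine _root_.exists_pow_eq_ratCast hθ0 (fun hk => hnd ?_) ha0 e4
  rw [hk, mul_right_inj' (pow_ne_zero _ hθ0.ne')] at e4
  rwa [show a j j' = a i j' - a i j by exact_mod_cast e4]

end

/-- The least exponent `r` making `θ ^ r` rational is at most the degree of `θ`: all conjugates of
`θ` have absolute value `θ`, so the norm of `θ` is a power of `θ` up to sign. -/
theorem le_natDegree_minpoly {θ : ℝ} (hθ : 0 < θ) {r : ℕ} (hr : 1 ≤ r) {s : ℚ} (hs : θ ^ r = s)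
    (hmin : ∀ m, 1 ≤ m → (∃ s : ℚ, θ ^ m = s) → r ≤ m) : r ≤ (minpoly ℚ θ).natDegree := by
  have hint : IsIntegral ℚ θ := by
    refine ⟨Polynomial.X ^ r - Polynomial.C s, Polynomial.monic_X_pow_sub_C s (by omega), ?_⟩
    simp [hs]
  set p := minpoly ℚ θ with hp
  have hmonic : p.Monic := minpoly.monic hint
  set P := p.map (algebraMap ℚ ℂ) with hP
  have hPm : P.Monic := hmonic.map _
  have hprod := (IsAlgClosed.splits P).coeff_zero_eq_prod_roots_of_monic hPm
  have hdvd : p ∣ Polynomial.X ^ r - Polynomial.C s := minpoly.dvd _ _ (by simp [hs])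
  have hroot : ∀ z ∈ P.roots, ‖z‖ = θ := by
    intro z hz
    rw [Polynomial.mem_roots hPm.ne_zero] at hz
    have h1 : (Polynomial.X ^ r - Polynomial.C (s : ℂ)).IsRoot z := by
      have h2 := Polynomial.map_dvd (algebraMap ℚ ℂ) hdvd
      simp only [Polynomial.map_sub, Polynomial.map_pow, Polynomial.map_X, Polynomial.map_C,
        eq_ratCast] at h2
      exact hz.dvd h2
    have h3 : z ^ r = s := by
      simpa [sub_eq_zero] using h1
    have h4 : ‖z‖ ^ r = θ ^ r := by
      rw [← norm_pow, h3, hs, ← Complex.ofReal_ratCast, Complex.norm_real, ← hs, Real.norm_eq_abs,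
        abs_of_pos (by positivity)]
    exact (pow_left_inj₀ (norm_nonneg _) hθ.le (by omega)).1 h4
  have hnorm : |(p.coeff 0 : ℝ)| = θ ^ p.natDegree := by
    have h1 : ‖P.coeff 0‖ = |(p.coeff 0 : ℝ)| := by
      rw [hP, Polynomial.coeff_map, eq_ratCast, ← Complex.ofReal_ratCast, Complex.norm_real,
        Real.norm_eq_abs]
    have h2 : ‖P.roots.prod‖ = θ ^ P.roots.card := by
      have h3 := map_multiset_prod (normHom : ℂ →*₀ ℝ) P.roots
      rw [show ‖P.roots.prod‖ = normHom P.roots.prod from rfl, h3]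
      change (P.roots.map fun z => ‖z‖).prod = _
      rw [Multiset.map_congr rfl hroot, Multiset.map_const', Multiset.prod_replicate]
    rw [← h1, hprod, norm_mul, norm_pow, norm_neg, norm_one, one_pow, one_mul, h2,
      ← (IsAlgClosed.splits P).natDegree_eq_card_roots, hP, Polynomial.natDegree_map]
  refine hmin _ (minpoly.natDegree_pos hint) ⟨|p.coeff 0|, ?_⟩
  rw [← hnorm]
  push_cast
  rfl

/-- Powers of `θ` in different residue classes mod `r` are linearly independent over `ℚ`; the case
of three terms. -/
theorem mod_eq_or_of_trinomial {θ : ℝ} (hθ : 0 < θ) {r : ℕ} (hr : 1 ≤ r) {s : ℚ} (hs : θ ^ r = s)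
    (hmin : ∀ m, 1 ≤ m → (∃ s : ℚ, θ ^ m = s) → r ≤ m) {i j k : ℕ} {a b c : ℤ} (ha : a ≠ 0)
    (h : θ ^ i * a + θ ^ j * b + θ ^ k * c = 0) : i % r = j % r ∨ i % r = k % r := by
  by_contra! hne
  have hs0 : s ≠ 0 := by
    rintro rfl
    rw [Rat.cast_zero] at hs
    exact pow_ne_zero _ hθ.ne' hs
  have hmod : ∀ m, θ ^ m = s ^ (m / r) * θ ^ (m % r) := by
    intro m
    conv_lhs => rw [← Nat.div_add_mod m r, pow_add, pow_mul, hs]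
  let p : Polynomial ℚ := Polynomial.C (s ^ (i / r) * a) * Polynomial.X ^ (i % r) +
    Polynomial.C (s ^ (j / r) * b) * Polynomial.X ^ (j % r) +
    Polynomial.C (s ^ (k / r) * c) * Polynomial.X ^ (k % r)
  have hp0 : p ≠ 0 := by
    intro h0
    have hc := congrArg (fun q => Polynomial.coeff q (i % r)) h0
    simp only [p, Polynomial.coeff_add, Polynomial.coeff_C_mul_X_pow, hne.1, hne.2, if_false,
      if_true, Polynomial.coeff_zero, add_zero, mul_eq_zero] at hc
    rcases hc with hc | hc
    · exact pow_ne_zero _ hs0 hc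
    · exact ha (by exact_mod_cast hc)
  have hroot : Polynomial.aeval θ p = 0 := by
    simp only [p, map_add, map_mul, Polynomial.aeval_C, map_pow, Polynomial.aeval_X, eq_ratCast,
      Rat.cast_intCast]
    rw [hmod i, hmod j, hmod k] at h
    linear_combination h
  have hdeg : p.degree < r := by
    have hlt : ∀ (q : ℚ) (m : ℕ),
        (Polynomial.C q * Polynomial.X ^ (m % r)).degree < (r : WithBot ℕ) := fun q m =>
      (Polynomial.degree_C_mul_X_pow_le _ _).trans_lt
        (by exact_mod_cast Nat.mod_lt m (by omega))
    exact (Polynomial.degree_add_le _ _).trans_lt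
      (max_lt ((Polynomial.degree_add_le _ _).trans_lt (max_lt (hlt _ _) (hlt _ _))) (hlt _ _))
  have h1 := Polynomial.natDegree_le_natDegree (minpoly.degree_le_of_ne_zero ℚ θ hp0 hroot)
  have h2 := le_natDegree_minpoly hθ hr hs hmin
  have h3 : p.natDegree < r := (Polynomial.natDegree_lt_iff_degree_lt hp0).2 hdeg
  omega

section
variable {ρ : ℝ} {N : ℕ} {Λ : Set ℝ}

theorem IsLevel.neg (h0 : 0 < ρ) (hN : 0 < N) {k : ℕ} {x : ℝ} (h : IsLevel ρ N k x) :
    IsLevel ρ N k (-x) := by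
  rw [isLevel_iff h0 hN] at h ⊢
  obtain ⟨hk, a, ha, hna⟩ := h
  refine ⟨hk, -a, ?_, by rwa [dvd_neg]⟩
  push_cast
  rw [mul_neg, ha, mul_neg]

/-- With `r` minimal, the levels of all differences agree mod `r`, by the linear independence of
powers of `ρ⁻¹`. Every level being needed, `r = 1`. -/
theorem IsParsevalSet.inv_eq_ratCast (h0 : 0 < ρ) (h1 : ρ < 1) (hN : 1 < N)
    (h : IsParsevalSet ρ N Λ) : ∃ s : ℚ, ρ⁻¹ = s := by
  classical
  have hN0 : 0 < N := by omega
  have hθ0 : 0 < ρ⁻¹ := by positivity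
  have hex := h.exists_pow_eq_ratCast h0 h1 hN
  obtain ⟨hr, s, hs⟩ := Nat.find_spec hex
  set r := Nat.find hex
  have hmin : ∀ m, 1 ≤ m → (∃ s : ℚ, ρ⁻¹ ^ m = s) → r ≤ m := fun m hm hms =>
    Nat.find_min' hex ⟨hm, hms⟩
  by_cases hr1 : r = 1
  · exact ⟨s, by rw [← hs, hr1, pow_one]⟩
  exfalso
  -- differences sharing an end point have congruent levels
  have hshare : ∀ x ∈ Λ, ∀ y ∈ Λ, ∀ z ∈ Λ, ∀ k k', IsLevel ρ N k (x - y) →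
      IsLevel ρ N k' (x - z) → k % r = k' % r := by
    intro x _ y hy z hz k k' hk hk'
    obtain ⟨-, a, ha, hna⟩ := (isLevel_iff h0 hN0).1 hk
    obtain ⟨-, b, hb, hnb⟩ := (isLevel_iff h0 hN0).1 hk'
    have ha0 : a ≠ 0 := fun h => hna (h ▸ dvd_zero _)
    have hb0 : b ≠ 0 := fun h => hnb (h ▸ dvd_zero _)
    by_cases hyz : z = y
    · subst hyz
      have := mod_eq_or_of_trinomial hθ0 hr hs hmin (i := k) (j := k') (k := k') (b := -b) (c := 0)
        ha0 (by push_cast; linear_combination hb - ha)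
      simpa using this
    · obtain ⟨m, hm⟩ := h.exists_isLevel h0 h1 hN hz hy hyz
      obtain ⟨-, c, hc, hnc⟩ := (isLevel_iff h0 hN0).1 hm
      have hc0 : c ≠ 0 := fun h => hnc (h ▸ dvd_zero _)
      have e1 := mod_eq_or_of_trinomial hθ0 hr hs hmin (i := k) (j := k') (k := m) (b := -b)
        (c := -c) ha0 (by push_cast; linear_combination hb + hc - ha)
      have e2 := mod_eq_or_of_trinomial hθ0 hr hs hmin (i := k') (j := k) (k := m) (b := -a)
        (c := c) hb0 (by push_cast; linear_combination ha - hb - hc)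
      have e3 := mod_eq_or_of_trinomial hθ0 hr hs hmin (i := m) (j := k) (k := k') (b := -a)
        (c := b) hc0 (by push_cast; linear_combination ha - hb - hc)
      omega
  -- a difference of some level `κ` and one of level `κ + 1`; they are congruent mod `r` as well
  obtain ⟨u, hu, v, hv, huv, -⟩ := h.exists_level_eq h0 h1 hN le_rfl
  obtain ⟨κ, hκ⟩ := h.exists_isLevel h0 h1 hN hu hv huv
  obtain ⟨x, hx, y, hy, hxy, hlev⟩ := h.exists_level_eq h0 h1 hN (k₀ := κ + 1) (by omega)
  obtain ⟨k, hk⟩ := h.exists_isLevel h0 h1 hN hx hy hxy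
  have hkκ : k % r = κ % r := by
    by_cases hxu : x = u
    · subst hxu
      exact hshare x hx y hy v hv k κ hk hκ
    · obtain ⟨m, hm⟩ := h.exists_isLevel h0 h1 hN hx hu hxu
      have hm' : IsLevel ρ N m (u - x) := by
        have := hm.neg h0 hN0
        rwa [neg_sub] at this
      exact (hshare x hx y hy u hu k m hk hm).trans (hshare u hu x hx v hv m κ hm' hκ)
  have h5 : κ + 1 ≡ κ [MOD r] := by rw [← hlev k hk]; exact hkκ
  have h6 : r ∣ (κ + 1) - κ := (Nat.modEq_iff_dvd' (Nat.le_succ κ)).1 h5.symm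
  rw [Nat.add_sub_cancel_left, Nat.dvd_one] at h6
  exact hr1 h6

end

/-! ### Rational, non-integer reciprocal ratio: growth of the frequencies -/

section
variable {ρ : ℝ} {N : ℕ} {Λ : Set ℝ}

theorem Padic.le_norm_ratCast_of_dvd_den {l : ℕ} [Fact l.Prime] {s : ℚ} (hl : l ∣ s.den) :
    (l : ℝ) ≤ ‖(s : ℚ_[l])‖ := by
  have hlp : l.Prime := Fact.out
  have hl0 : (0 : ℝ) < l := by exact_mod_cast hlp.pos
  have hnum : ‖(s.num : ℚ_[l])‖ = 1 := by
    refine le_antisymm (Padic.norm_int_le_one _) (not_lt.1 fun h => ?_)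
    have h1 := (Padic.norm_intCast_lt_one_iff).1 h
    have h2 : l ∣ s.num.natAbs := Int.natCast_dvd.1 h1
    exact hlp.one_lt.ne' (Nat.eq_one_of_dvd_coprimes s.reduced h2 hl)
  have hden : ‖((s.den : ℤ) : ℚ_[l])‖ ≤ (l : ℝ)⁻¹ := by
    have := (Padic.norm_int_le_pow_iff_dvd (p := l) s.den 1).2 (by
      rw [pow_one]; exact_mod_cast hl)
    simpa using this
  have hden0 : (0 : ℝ) < ‖((s.den : ℤ) : ℚ_[l])‖ := by
    rw [norm_pos_iff]
    exact_mod_cast s.den_nz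
  have hs : ‖(s : ℚ_[l])‖ = ‖((s.den : ℤ) : ℚ_[l])‖⁻¹ := by
    have h3 : (s : ℚ_[l]) = (s.num : ℚ_[l]) / ((s.den : ℤ) : ℚ_[l]) := by
      rw [Rat.cast_def]; push_cast; rfl
    rw [h3, norm_div, hnum, one_div]
  rw [hs, le_inv_comm₀ hl0 hden0]
  exact hden

/-- If a prime `l` divides the denominator of `ρ⁻¹`, the `l`-adic absolute values of the differences
are bounded, since otherwise the levels along some sequence would tend to infinity. So the
coefficient of a difference of level `k` is divisible by `l ^ k`, up to a bounded power of `l`, and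
the difference is larger than its level alone requires. -/
theorem IsParsevalSet.exists_growth (h0 : 0 < ρ) (h1 : ρ < 1) (hN : 1 < N)
    (h : IsParsevalSet ρ N Λ) {s : ℚ} (hs : ρ⁻¹ = s) {l : ℕ} (hl : l.Prime) (hls : l ∣ s.den) :
    ∃ c : ℝ, 0 < c ∧ ∀ x ∈ Λ, ∀ y ∈ Λ, x ≠ y → ∀ k, IsLevel ρ N k (x - y) →
      c * (ρ⁻¹ * l) ^ k ≤ |x - y| := by
  classical
  have : Fact l.Prime := ⟨hl⟩
  have hN0 : 0 < N := by omega
  have hNR : (0 : ℝ) < N := by exact_mod_cast hN0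
  have hθ : 1 < ρ⁻¹ := one_lt_inv₀ h0 |>.2 h1
  have hl1 : (1 : ℝ) < l := by exact_mod_cast hl.one_lt
  have hsl := Padic.le_norm_ratCast_of_dvd_den hls
  obtain ⟨l₀, hl₀⟩ := h.nonempty
  have hw : ∀ x : Λ, ∃ w : ℚ, (N : ℝ) * (x - l₀) = w := by
    intro x
    by_cases hx : (x : ℝ) = l₀
    · exact ⟨0, by simp [hx]⟩
    · obtain ⟨k, hk⟩ := h.exists_isLevel h0 h1 hN x.2 hl₀ hx
      obtain ⟨-, a, ha, -⟩ := (isLevel_iff h0 hN0).1 hk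
      exact ⟨s ^ k * a, by rw [ha, hs]; push_cast; rfl⟩
  choose w hw using hw
  have hdiff : ∀ (x y : Λ) (k : ℕ) (a : ℤ), (N : ℝ) * ((x : ℝ) - y) = ρ⁻¹ ^ k * a →
      ‖((w x : ℚ_[l]) - w y)‖ = ‖(s : ℚ_[l])‖ ^ k * ‖(a : ℚ_[l])‖ := by
    intro x y k a he
    have h2 : w x - w y = s ^ k * a := by
      have h3 : ((w x - w y : ℚ) : ℝ) = ((s ^ k * a : ℚ) : ℝ) := by
        push_cast
        rw [← hw, ← hw, ← hs, ← he]
        ring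
      exact_mod_cast h3
    have h4 : (w x : ℚ_[l]) - w y = (s : ℚ_[l]) ^ k * a := by
      exact_mod_cast congrArg (Rat.cast : ℚ → ℚ_[l]) h2
    rw [h4, norm_mul, norm_pow]
  -- if unbounded, a sequence with increasing `l`-adic norms has levels tending to infinity
  obtain ⟨B, hB⟩ : ∃ B : ℝ, ∀ x : Λ, ‖(w x : ℚ_[l])‖ ≤ B := by
    by_contra! hunb
    set g : Λ → ℝ := fun x => ‖(w x : ℚ_[l])‖ with hg
    obtain ⟨f, -, hf⟩ := exists_seq_of_forall_finset_exists (fun _ : Λ => True)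
      (fun x y => g x + 1 ≤ g y) (fun S _ => by
        obtain ⟨M, hM⟩ := (S.image g).exists_le
        obtain ⟨y, hy⟩ := hunb (M + 1)
        refine ⟨y, trivial, fun x hx => ?_⟩
        have := hM (g x) (Finset.mem_image_of_mem g hx)
        change _ < g y at hy
        linarith)
    have hgn : ∀ n : ℕ, (n : ℝ) ≤ g (f n) := by
      intro n
      induction n with
      | zero => rw [Nat.cast_zero]; exact norm_nonneg _
      | succ n ih =>
        have := hf n (n + 1) (Nat.lt_succ_self n)
        push_cast
        linarith
    have hne : ∀ i j, i ≠ j → (f i : ℝ) ≠ f j := by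
      intro i j hij he
      have he' : f i = f j := Subtype.ext he
      rcases lt_or_gt_of_ne hij with hlt | hlt
      · have := hf i j hlt; rw [he'] at this; linarith
      · have := hf j i hlt; rw [he'] at this; linarith
    have hex : ∀ i j, ∃ (k : ℕ) (a : ℤ), i ≠ j →
        (N : ℝ) * ((f j : ℝ) - f i) = ρ⁻¹ ^ k * a ∧ ¬ (N : ℤ) ∣ a := by
      intro i j
      by_cases hij : i = j
      · exact ⟨0, 0, fun hne => absurd hij hne⟩
      · obtain ⟨k, hk⟩ := h.exists_isLevel h0 h1 hN (f j).2 (f i).2 (hne j i (Ne.symm hij))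
        obtain ⟨-, a, ha, hna⟩ := (isLevel_iff h0 hN0).1 hk
        exact ⟨k, a, fun _ => ⟨ha, hna⟩⟩
    choose k a hka using hex
    refine levels_not_tendsto hθ hN0 (fun j => N * f j) k a
      (fun i j hij => by rw [← (hka i j hij).1]; ring) (fun i j hij => (hka i j hij).2) fun i => ?_
    refine Tendsto.mono_left ?_ Nat.hyperfilter_le_atTop
    rw [tendsto_atTop]
    intro b
    obtain ⟨n₀, hn₀⟩ := exists_nat_gt (‖(s : ℚ_[l])‖ ^ b)
    filter_upwards [eventually_gt_atTop i, eventually_ge_atTop n₀] with j hij hj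
    by_contra! hlt
    have h2 := hdiff (f j) (f i) _ _ (hka i j hij.ne).1
    have h3 : ‖(w (f j) : ℚ_[l]) - w (f i)‖ = ‖(w (f j) : ℚ_[l])‖ := by
      have hlt' : ‖(w (f i) : ℚ_[l])‖ < ‖(w (f j) : ℚ_[l])‖ := by
        have := hf i j hij
        change ‖(w (f i) : ℚ_[l])‖ + 1 ≤ ‖(w (f j) : ℚ_[l])‖ at this
        linarith
      refine IsUltrametricDist.norm_eq_of_add_norm_lt_max
        (y := -(w (f j) : ℚ_[l])) ?_ |>.trans (norm_neg _)
      rw [norm_neg, show (w (f j) : ℚ_[l]) - w (f i) + -(w (f j) : ℚ_[l]) = -(w (f i) : ℚ_[l]) by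
        ring, norm_neg]
      exact hlt'.trans_le (le_max_right _ _)
    have h4 : (j : ℝ) ≤ ‖(s : ℚ_[l])‖ ^ b := by
      calc (j : ℝ) ≤ ‖(w (f j) : ℚ_[l])‖ := hgn j
        _ = ‖(s : ℚ_[l])‖ ^ k i j * ‖(a i j : ℚ_[l])‖ := by rw [← h3, h2]
        _ ≤ ‖(s : ℚ_[l])‖ ^ k i j :=
          mul_le_of_le_one_right (by positivity) (Padic.norm_int_le_one _)
        _ ≤ _ := pow_le_pow_right₀ (hl1.le.trans hsl) hlt.le
    have h5 : (n₀ : ℝ) ≤ j := by exact_mod_cast hj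
    linarith
  obtain ⟨M, hM⟩ := pow_unbounded_of_one_lt B hl1
  have hlM : (0 : ℝ) < (l : ℝ) ^ M := by positivity
  refine ⟨(N * (l : ℝ) ^ M)⁻¹, by positivity, fun x hx y hy hxy k hk => ?_⟩
  obtain ⟨-, a, ha, hna⟩ := (isLevel_iff h0 hN0).1 hk
  have ha0 : a ≠ 0 := fun h => hna (h ▸ dvd_zero _)
  have habs : (l : ℝ) ^ k ≤ (l : ℝ) ^ M * |(a : ℝ)| := by
    have ha1 : (1 : ℝ) ≤ |(a : ℝ)| := by exact_mod_cast Int.one_le_abs ha0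
    rcases le_total k M with hkM | hMk
    · exact (pow_le_pow_right₀ hl1.le hkM).trans (le_mul_of_one_le_right hlM.le ha1)
    · have h2 := hdiff ⟨x, hx⟩ ⟨y, hy⟩ k a ha
      have h3 : ‖(w ⟨x, hx⟩ : ℚ_[l]) - w ⟨y, hy⟩‖ ≤ B := by
        have := IsUltrametricDist.norm_add_le_max (w ⟨x, hx⟩ : ℚ_[l]) (-(w ⟨y, hy⟩ : ℚ_[l]))
        rw [norm_neg, ← sub_eq_add_neg] at this
        exact this.trans (max_le (hB _) (hB _))
      have h4 : (l : ℝ) ^ k * ‖(a : ℚ_[l])‖ ≤ (l : ℝ) ^ M := by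
        calc _ ≤ ‖(s : ℚ_[l])‖ ^ k * ‖(a : ℚ_[l])‖ := by gcongr
          _ ≤ _ := by rw [← h2]; exact h3.trans hM.le
      have h5 : ‖(a : ℚ_[l])‖ ≤ (l : ℝ) ^ (-((k - M : ℕ) : ℤ)) := by
        rw [zpow_neg, zpow_natCast, ← one_div, le_div_iff₀ (by positivity)]
        have h6 : (l : ℝ) ^ k = (l : ℝ) ^ M * (l : ℝ) ^ (k - M) := by
          rw [← pow_add, Nat.add_sub_cancel' hMk]
        rw [h6] at h4
        nlinarith
      have h6 := (Padic.norm_int_le_pow_iff_dvd (p := l) a (k - M)).1 h5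
      have h7 := Int.le_of_dvd (abs_pos.2 ha0) ((dvd_abs _ _).2 h6)
      have h8 : (l : ℝ) ^ (k - M) ≤ |(a : ℝ)| := by exact_mod_cast h7
      calc (l : ℝ) ^ k = (l : ℝ) ^ M * (l : ℝ) ^ (k - M) := by
            rw [← pow_add, Nat.add_sub_cancel' hMk]
        _ ≤ _ := by gcongr
  have hxy' : (N : ℝ) * |x - y| = ρ⁻¹ ^ k * |(a : ℝ)| := by
    rw [← Nat.abs_cast N, ← abs_mul, ha, abs_mul, abs_of_nonneg (by positivity : 0 ≤ ρ⁻¹ ^ k)]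
  rw [inv_mul_le_iff₀ (by positivity), mul_pow]
  calc ρ⁻¹ ^ k * (l : ℝ) ^ k ≤ ρ⁻¹ ^ k * ((l : ℝ) ^ M * |(a : ℝ)|) := by gcongr
    _ = (l : ℝ) ^ M * (N * |x - y|) := by rw [hxy']; ring
    _ = _ := by ring

/-! ### Rational, non-integer reciprocal ratio: decay of the Fourier transform -/

/-- Away from the integers `expMean N` is bounded away from `1` in absolute value. -/
theorem exists_norm_expMean_le (hN : 1 < N) {δ : ℝ} (hδ : 0 < δ) :
    ∃ κ : ℝ, 0 < κ ∧ κ < 1 ∧ ∀ t : ℝ, (∀ a : ℤ, δ ≤ |t - a|) → ‖expMean N t‖ ≤ κ := by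
  have hmem : ∀ t : ℝ, (∀ a : ℤ, δ ≤ |t - a|) → Int.fract t ∈ Set.Icc δ (1 - δ) := by
    intro t ht
    constructor
    · have := ht ⌊t⌋
      rwa [Int.self_sub_floor, abs_of_nonneg (Int.fract_nonneg t)] at this
    · have := ht (⌊t⌋ + 1)
      have h1 : t - ((⌊t⌋ + 1 : ℤ) : ℝ) = -(1 - Int.fract t) := by
        rw [Int.fract]; push_cast; ring
      rw [h1, abs_neg, abs_of_pos (by linarith [Int.fract_lt_one t])] at this
      linarith
  have hfract : ∀ t : ℝ, expMean N t = expMean N (Int.fract t) := by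
    intro t
    conv_lhs => rw [← Int.fract_add_floor t]
    exact expMean_add_intCast _ _ _
  rcases (Set.Icc δ (1 - δ)).eq_empty_or_nonempty with he | hne
  · exact ⟨1 / 2, by norm_num, by norm_num, fun t ht => by simpa [he] using hmem t ht⟩
  · obtain ⟨t₀, ht₀, hmax⟩ := isCompact_Icc.exists_isMaxOn hne
      (continuous_expMean N).norm.continuousOn
    have hlt : ‖expMean N t₀‖ < 1 := by
      refine norm_expMean_lt_one hN fun a ha => ?_
      have h1 : (0 : ℝ) < a := ha ▸ (hδ.trans_le ht₀.1)
      have h2 : (a : ℝ) < 1 := by rw [← ha]; linarith [ht₀.2]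
      have h3 : 0 < a := by exact_mod_cast h1
      have h4 : a < 1 := by exact_mod_cast h2
      omega
    refine ⟨max ‖expMean N t₀‖ (1 / 2), by positivity, max_lt hlt (by norm_num), fun t ht => ?_⟩
    rw [hfract]
    exact (hmax (hmem t ht)).trans (le_max_left _ _)

/-- In a geometric progression with rational ratio `s > 1` of denominator at least `2`, the terms
cannot stay close to integers for long: the first of `L + 1` consecutive close integers is divisible
by the `L`-th power of the denominator. -/
theorem exists_far_from_int {s : ℚ} (hs : 1 < s) (hden : 1 < s.den) :
    ∃ δ : ℝ, 0 < δ ∧ ∃ h : ℕ, ∀ w : ℝ, 1 ≤ |w| → |w| < s → ∀ t : ℕ,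
      ∃ i, t ≤ i ∧ i ≤ t + h * (t + 1) ∧ ∀ a : ℤ, δ ≤ |(s : ℝ) ^ i * w - a| := by
  set q : ℕ := s.den with hq
  set p : ℤ := s.num with hp
  have hq0 : (0 : ℝ) < q := by exact_mod_cast s.den_pos
  have hp0 : 0 < p := Rat.num_pos.2 (by linarith)
  have hpR : (0 : ℝ) < p := by exact_mod_cast hp0
  have hsp : (s : ℝ) * q = p := by exact_mod_cast Rat.mul_den_eq_num s
  have hs1 : (1 : ℝ) < s := by exact_mod_cast hs
  have hcop : IsCoprime (q : ℤ) p := by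
    rw [isCoprime_comm, Int.isCoprime_iff_gcd_eq_one]
    exact s.reduced
  have hq1 : (1 : ℝ) < q := by exact_mod_cast hden
  obtain ⟨h, hh⟩ := pow_unbounded_of_one_lt (2 * (s : ℝ)) hq1
  have hδ1 : 1 / ((p : ℝ) + q) < 1 := by
    rw [div_lt_one (by positivity)]; linarith
  -- with this `δ` consecutive nearest integers satisfy `q n' = p n` exactly
  refine ⟨1 / (p + q), by positivity, h, fun w hw1 hw2 t => ?_⟩
  set L := h * (t + 1) with hL
  by_contra! hcon
  choose! n hn using hcon
  have hstep : ∀ i, t ≤ i → i + 1 ≤ t + L → (q : ℤ) * n (i + 1) = p * n i := by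
    intro i hi1 hi2
    have e1 := hn i hi1 (by omega)
    have e2 := hn (i + 1) (by omega) hi2
    have e3 : |((q * n (i + 1) - p * n i : ℤ) : ℝ)| < 1 := by
      have e4 : ((q * n (i + 1) - p * n i : ℤ) : ℝ) =
          p * ((s : ℝ) ^ i * w - n i) - q * ((s : ℝ) ^ (i + 1) * w - n (i + 1)) := by
        push_cast
        rw [pow_succ]
        linear_combination (s : ℝ) ^ i * w * hsp
      rw [e4]
      calc _ ≤ |p * ((s : ℝ) ^ i * w - n i)| + |q * ((s : ℝ) ^ (i + 1) * w - n (i + 1))| :=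
            abs_sub _ _
        _ = p * |(s : ℝ) ^ i * w - n i| + q * |(s : ℝ) ^ (i + 1) * w - n (i + 1)| := by
            rw [abs_mul, abs_mul, abs_of_pos hpR, abs_of_pos hq0]
        _ < p * (1 / (p + q)) + q * (1 / (p + q)) := by gcongr
        _ = 1 := by field_simp
    have e5 := Int.abs_lt_one_iff.1 (by exact_mod_cast e3 : |(q * n (i + 1) - p * n i : ℤ)| < 1)
    linarith
  have hiter : ∀ j, j ≤ L → (q : ℤ) ^ j * n (t + j) = p ^ j * n t := by
    intro j
    induction j with
    | zero => simp
    | succ j ih =>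
      intro hj
      have e1 := ih (by omega)
      have e2 := hstep (t + j) (by omega) (by omega)
      rw [← add_assoc, pow_succ, pow_succ]
      linear_combination (q : ℤ) ^ j * e2 + p * e1
  have hdvd : (q : ℤ) ^ L ∣ n t :=
    (hcop.pow (m := L) (n := L)).dvd_of_dvd_mul_left ⟨n (t + L), (hiter L le_rfl).symm⟩
  have hnt := hn t le_rfl (by omega)
  have hwt : 1 ≤ |(s : ℝ) ^ t * w| := by
    rw [abs_mul, abs_of_pos (by positivity)]
    exact one_le_mul_of_one_le_of_one_le (one_le_pow₀ hs1.le) hw1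
  have hnt0 : n t ≠ 0 := by
    intro h0
    rw [h0, Int.cast_zero, sub_zero] at hnt
    linarith
  have hge : (q : ℝ) ^ L ≤ |(n t : ℝ)| := by
    have := Int.le_of_dvd (abs_pos.2 hnt0) ((dvd_abs _ _).2 hdvd)
    exact_mod_cast this
  have hlt : |(n t : ℝ)| < (s : ℝ) ^ (t + 1) + 1 := by
    have e1 : |(n t : ℝ)| ≤ |(s : ℝ) ^ t * w| + |(s : ℝ) ^ t * w - n t| := by
      have := abs_sub ((s : ℝ) ^ t * w) ((s : ℝ) ^ t * w - n t)
      rwa [sub_sub_cancel] at this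
    have e2 : |(s : ℝ) ^ t * w| ≤ (s : ℝ) ^ (t + 1) := by
      rw [abs_mul, abs_of_pos (by positivity), pow_succ]
      gcongr
    linarith
  have hbig : (s : ℝ) ^ (t + 1) + 1 ≤ (q : ℝ) ^ L := by
    have e1 : (1 : ℝ) ≤ (s : ℝ) ^ (t + 1) := one_le_pow₀ hs1.le
    have e2 : (2 : ℝ) ≤ 2 ^ (t + 1) := by
      have := pow_le_pow_right₀ (one_le_two (α := ℝ)) (Nat.succ_le_succ (Nat.zero_le t))
      simpa using this
    calc (s : ℝ) ^ (t + 1) + 1 ≤ 2 * (s : ℝ) ^ (t + 1) := by linarith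
      _ ≤ 2 ^ (t + 1) * (s : ℝ) ^ (t + 1) := by gcongr
      _ = (2 * (s : ℝ)) ^ (t + 1) := (mul_pow _ _ _).symm
      _ ≤ ((q : ℝ) ^ h) ^ (t + 1) := by gcongr
      _ = (q : ℝ) ^ L := by rw [← pow_mul]
  linarith

theorem fourierSelfSimilar_pow_mul (h0 : 0 < ρ) (h1 : ρ < 1) (hN : 0 < N) (n : ℕ) (w : ℝ) :
    fourierSelfSimilar ρ N (ρ⁻¹ ^ n * w) =
      (∏ i ∈ Finset.range n, expMean N (ρ⁻¹ ^ i * w)) * fourierSelfSimilar ρ N w := by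
  induction n with
  | zero => simp
  | succ n ih =>
    have : ρ * (ρ⁻¹ ^ (n + 1) * w) = ρ⁻¹ ^ n * w := by
      rw [pow_succ]; field_simp
    rw [fourierSelfSimilar_step h0 h1 hN, this, ih, Finset.prod_range_succ]
    ring

/-- Doubly exponential scales: each of them contributes a factor bounded away from `1`. This is
decay at the rate of a power of the logarithm. -/
theorem exists_decay (h0 : 0 < ρ) (h1 : ρ < 1) (hN : 1 < N) {s : ℚ} (hs : ρ⁻¹ = s)
    (hden : 1 < s.den) : ∃ κ : ℝ, 0 < κ ∧ κ < 1 ∧ ∃ C : ℕ, 2 ≤ C ∧ ∀ (j : ℕ) (y : ℝ),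
      ρ⁻¹ ^ (C ^ j) ≤ |y| → ‖fourierSelfSimilar ρ N y‖ ≤ κ ^ j := by
  have hN0 : 0 < N := by omega
  have hθ : 1 < ρ⁻¹ := one_lt_inv₀ h0 |>.2 h1
  have hs1 : 1 < s := by rw [hs] at hθ; exact_mod_cast hθ
  obtain ⟨δ, hδ, h, hfar⟩ := exists_far_from_int hs1 hden
  obtain ⟨κ, hκ0, hκ1, hκ⟩ := exists_norm_expMean_le hN hδ
  refine ⟨κ, hκ0, hκ1, 2 * h + 2, by omega, ?_⟩
  set C := 2 * h + 2 with hC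
  have hprod : ∀ w : ℝ, 1 ≤ |w| → |w| < ρ⁻¹ → ∀ j n : ℕ, C ^ j ≤ n →
      ∏ i ∈ Finset.range n, ‖expMean N (ρ⁻¹ ^ i * w)‖ ≤ κ ^ j := by
    intro w hw1 hw2 j
    induction j with
    | zero =>
      intro n _
      exact Finset.prod_le_one (fun _ _ => norm_nonneg _) fun _ _ => norm_expMean_le_one _ _
    | succ j ih =>
      intro n hn
      -- one factor with index in `[C ^ j, C ^ (j + 1))` is at most `κ`
      obtain ⟨i, hi1, hi2, hi3⟩ := hfar w hw1 (hs ▸ hw2) (C ^ j)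
      have hCj : 1 ≤ C ^ j := Nat.one_le_pow _ _ (by omega)
      have hin : i < n := by
        refine lt_of_lt_of_le ?_ hn
        have e1 : h ≤ h * C ^ j := Nat.le_mul_of_pos_right h hCj
        have e2 : C ^ (j + 1) = 2 * (h * C ^ j) + 2 * C ^ j := by
          rw [pow_succ, mul_comm (C ^ j) C]
          nth_rewrite 1 [hC]
          ring
        rw [mul_add, mul_one] at hi2
        omega
      calc ∏ i ∈ Finset.range n, ‖expMean N (ρ⁻¹ ^ i * w)‖
          ≤ ∏ i ∈ insert i (Finset.range (C ^ j)), ‖expMean N (ρ⁻¹ ^ i * w)‖ := by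
            refine Finset.prod_le_prod_of_subset_of_le_one ?_ (fun _ _ => norm_nonneg _)
              fun _ _ _ => norm_expMean_le_one _ _
            intro m hm
            rw [Finset.mem_insert, Finset.mem_range] at hm
            rw [Finset.mem_range]
            omega
        _ = ‖expMean N (ρ⁻¹ ^ i * w)‖ *
            ∏ i ∈ Finset.range (C ^ j), ‖expMean N (ρ⁻¹ ^ i * w)‖ :=
          Finset.prod_insert (by rw [Finset.mem_range]; omega)
        _ ≤ κ * κ ^ j := by
            refine mul_le_mul ?_ (ih _ le_rfl)
              (Finset.prod_nonneg fun _ _ => norm_nonneg _) hκ0.le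
            exact hκ _ (by rw [hs]; exact hi3)
        _ = κ ^ (j + 1) := (pow_succ' _ _).symm
  intro j y hy
  have hy1 : 1 ≤ |y| := (one_le_pow₀ hθ.le).trans hy
  obtain ⟨n, hn1, hn2⟩ := exists_nat_pow_near hy1 hθ
  have hρn : (0 : ℝ) < ρ⁻¹ ^ n := by positivity
  have hyw : y = ρ⁻¹ ^ n * (y / ρ⁻¹ ^ n) := by field_simp
  have habs : |y / ρ⁻¹ ^ n| = |y| / ρ⁻¹ ^ n := by rw [abs_div, abs_of_pos hρn]
  have hjn : C ^ j ≤ n := by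
    have := (pow_lt_pow_iff_right₀ hθ).1 (hy.trans_lt hn2)
    omega
  rw [hyw, fourierSelfSimilar_pow_mul h0 h1 hN0, norm_mul, norm_prod]
  refine (mul_le_of_le_one_right (Finset.prod_nonneg fun _ _ => norm_nonneg _)
    (norm_fourierSelfSimilar_le_one h0 h1 hN0 _)).trans (hprod _ ?_ ?_ j n hjn)
  · rw [habs, le_div_iff₀ hρn, one_mul]; exact hn1
  · rw [habs, div_lt_iff₀ hρn]
    rwa [pow_succ'] at hn2

end

/-! ### Rational, non-integer reciprocal ratio: Parseval's identity fails -/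

section
variable {ρ : ℝ} {N : ℕ} {Λ : Set ℝ}

/-- The part of Parseval's sum for `e(-ξ x)` carried by the frequencies in `S`. -/
noncomputable def parsevalMass (ρ : ℝ) (N : ℕ) {Λ : Set ℝ} (ξ : ℝ) (S : Set Λ) : ℝ :=
  ∑' l : Λ, S.indicator (fun l : Λ => ‖fourierSelfSimilar ρ N (ξ + l)‖ ^ 2) l

/-- Frequencies in `T \ S` at which the tail `t ↦ F (ρ ^ m t)` of the transform is small take up at
most a small part of what `S` leaves, by Bessel's inequality for the product of the first `m`
factors. -/
theorem IsParsevalSet.mass_step (h0 : 0 < ρ) (h1 : ρ < 1) (hN : 1 < N)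
    (h : IsParsevalSet ρ N Λ) {S T : Set Λ} (hST : S ⊆ T) {m : ℕ}
    (hm : ∀ x ∈ T, ∀ y ∈ T, x ≠ y → ∃ k ≤ m, IsLevel ρ N k ((x : ℝ) - y)) {ξ ε : ℝ} (hε : 0 ≤ ε)
    (hsmall : ∀ x ∈ T, x ∉ S → ‖fourierSelfSimilar ρ N (ρ ^ m * (ξ + x))‖ ^ 2 ≤ ε) :
    (1 - ε) * (1 - parsevalMass ρ N ξ S) ≤ 1 - parsevalMass ρ N ξ T := by
  classical
  have hN0 : 0 < N := by omega
  set a : Λ → ℝ := fun l => ‖fourierSelfSimilar ρ N (ξ + l)‖ ^ 2 with ha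
  have hsum : Summable a := (h.2 ξ).summable
  let M : ℝ → ℂ := fun t => ∏ k ∈ Finset.Icc 1 m, expMean N (ρ ^ k * t)
  have hM : IsTrigMean M := isTrigMean_prod _ _ fun k _ => isTrigMean_expMean hN0 _
  have haM : ∀ l : Λ, a l =
      ‖M (ξ + l)‖ ^ 2 * ‖fourierSelfSimilar ρ N (ρ ^ m * (ξ + l))‖ ^ 2 := by
    intro l
    rw [ha, ← mul_pow, ← norm_mul]
    simp only [M]
    rw [← fourierSelfSimilar_eq_prod h0 h1 hN0]
  have hfin : ∀ s : Finset Λ,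
      ∑ l ∈ s, ((T \ S).indicator a l + ε * S.indicator a l) ≤ ε := by
    intro s
    have hb := hM.sum_le_one ((s.filter (· ∈ T)).map (Function.Embedding.subtype _)) (by
      intro x hx y hy hxy
      simp only [Finset.mem_map, Finset.mem_filter, Function.Embedding.subtype_apply] at hx hy
      obtain ⟨x, ⟨-, hxT⟩, rfl⟩ := hx
      obtain ⟨y, ⟨-, hyT⟩, rfl⟩ := hy
      obtain ⟨k, hkm, hk⟩ := hm x hxT y hyT fun he => hxy (by rw [he])
      exact Finset.prod_eq_zero (i := k) (Finset.mem_Icc.2 ⟨hk.1, hkm⟩) hk.2) ξ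
    rw [Finset.sum_map, Finset.sum_filter] at hb
    simp only [Function.Embedding.subtype_apply] at hb
    calc _ ≤ ∑ l ∈ s, ε * (if l ∈ T then ‖M (ξ + l)‖ ^ 2 else 0) := by
          refine Finset.sum_le_sum fun l _ => ?_
          by_cases hlS : l ∈ S
          · have hlT := hST hlS
            simp only [Set.indicator, Set.mem_sdiff, hlS, hlT, not_true, and_false, if_true,
              if_false, zero_add]
            refine mul_le_mul_of_nonneg_left ?_ hε
            rw [haM]
            exact mul_le_of_le_one_right (by positivity)
              (pow_le_one₀ (norm_nonneg _) (norm_fourierSelfSimilar_le_one h0 h1 hN0 _))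
          · by_cases hlT : l ∈ T
            · simp only [Set.indicator, Set.mem_sdiff, hlS, hlT, not_false_iff, and_true, if_true,
                if_false, mul_zero, add_zero]
              rw [haM, mul_comm ε]
              exact mul_le_mul_of_nonneg_left (hsmall l hlT hlS) (by positivity)
            · simp [Set.indicator, hlS, hlT]
      _ ≤ ε := by
          rw [← Finset.mul_sum]
          exact mul_le_of_le_one_right hε hb
  have hs1 := hsum.indicator (T \ S)
  have hs2 := hsum.indicator S
  have hle : parsevalMass ρ N ξ (T \ S) + ε * parsevalMass ρ N ξ S ≤ ε := by
    have := (hs1.add (hs2.mul_left ε)).tsum_le_of_sum_le hfin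
    rwa [hs1.tsum_add (hs2.mul_left ε), tsum_mul_left] at this
  have hadd : parsevalMass ρ N ξ T = parsevalMass ρ N ξ (T \ S) + parsevalMass ρ N ξ S := by
    rw [parsevalMass, parsevalMass, parsevalMass, ← hs1.tsum_add hs2]
    refine tsum_congr fun l => ?_
    change T.indicator a l = (T \ S).indicator a l + S.indicator a l
    by_cases hlS : l ∈ S
    · simp [Set.indicator, hlS, hST hlS]
    · simp [Set.indicator, hlS]
  rw [hadd]
  linarith

theorem half_le_of_geometric_decay {x ε : ℕ → ℝ} (hx : 0 ≤ x 0) (hε : ∀ j, 0 ≤ ε j)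
    (hsum : ∀ j, ∑ i ∈ Finset.range j, ε i ≤ 1 / 2)
    (hstep : ∀ j, (1 - ε j) * x j ≤ x (j + 1)) (j : ℕ) : x 0 / 2 ≤ x j := by
  have key : ∀ j, (1 - ∑ i ∈ Finset.range j, ε i) * x 0 ≤ x j := by
    intro j
    induction j with
    | zero => simp
    | succ j ih =>
      have h1 := hsum j
      have h2 := hsum (j + 1)
      rw [Finset.sum_range_succ] at h2 ⊢
      have h3 : 0 ≤ ∑ i ∈ Finset.range j, ε i := Finset.sum_nonneg fun i _ => hε i
      have h4 : (1 - ε j) * ((1 - ∑ i ∈ Finset.range j, ε i) * x 0) ≤ (1 - ε j) * x j :=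
        mul_le_mul_of_nonneg_left ih (by linarith)
      have h5 : 0 ≤ ε j * (∑ i ∈ Finset.range j, ε i) * x 0 :=
        mul_nonneg (mul_nonneg (hε j) h3) hx
      have h6 := hstep j
      nlinarith
  have h1 := key j
  have h2 := hsum j
  nlinarith

theorem countable_zeros (h0 : 0 < ρ) (h1 : ρ < 1) (hN : 0 < N) :
    {x : ℝ | fourierSelfSimilar ρ N x = 0}.Countable := by
  refine (Set.countable_range (fun p : ℕ × ℤ => ρ⁻¹ ^ p.1 * (p.2 : ℝ) / N)).mono fun x hx => ?_
  obtain ⟨k, hk⟩ := exists_isLevel h0 h1 hN hx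
  obtain ⟨-, a, ha, -⟩ := (isLevel_iff h0 hN).1 hk
  refine ⟨(k, a), ?_⟩
  have hN' : (N : ℝ) ≠ 0 := by exact_mod_cast hN.ne'
  simp only
  rw [← ha, mul_div_cancel_left₀ _ hN']

theorem IsParsevalSet.parsevalMass_le_one (h : IsParsevalSet ρ N Λ) (ξ : ℝ) (S : Set Λ) :
    parsevalMass ρ N ξ S ≤ 1 := by
  rw [← (h.2 ξ).tsum_eq]
  exact ((h.2 ξ).summable.indicator _).tsum_le_tsum
    (fun l => Set.indicator_le_self' (fun _ _ => by positivity) l) (h.2 ξ).summable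

/-- Against the sparse frequencies the transform decays fast: with `S n` the frequencies below
`c (ρ⁻¹ l) ^ n / 2`, the remainder `1 - mass (S n)` loses at most a factor `1 - κ ^ j` from `n` to
`n + C ^ j` when `n ≥ A C ^ j`. Passing from `A C ^ j` to `A C ^ (j + 1)` takes a number `H` of such
steps which does not depend on `j`. -/
theorem IsParsevalSet.exists_exhaustion (h0 : 0 < ρ) (h1 : ρ < 1) (hN : 1 < N)
    (h : IsParsevalSet ρ N Λ) {s : ℚ} (hs : ρ⁻¹ = s) (hden1 : s.den ≠ 1) :
    ∃ (S : ℕ → Set Λ) (κ : ℝ) (H j₁ : ℕ), Monotone S ∧ (∀ x, ∃ n, x ∈ S n) ∧ (∀ n, ∃ x, x ∉ S n) ∧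
      0 < κ ∧ κ < 1 ∧ ∀ ξ : ℝ, |ξ| ≤ 1 → ∀ j, j₁ ≤ j →
        (1 - H * κ ^ j) * (1 - parsevalMass ρ N ξ (S j)) ≤
          1 - parsevalMass ρ N ξ (S (j + 1)) := by
  have hden : 1 < s.den := by have := s.den_pos; omega
  have hN0 : 0 < N := by omega
  set θ := ρ⁻¹ with hθdef
  have hθ : 1 < θ := one_lt_inv₀ h0 |>.2 h1
  have hθ0 : 0 < θ := by positivity
  obtain ⟨l, hl, hls⟩ := Nat.exists_prime_and_dvd hden1
  have hl1 : (1 : ℝ) < l := by exact_mod_cast hl.one_lt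
  obtain ⟨c, hc, hgrow⟩ := h.exists_growth h0 h1 hN hs hl hls
  obtain ⟨κ, hκ0, hκ1, C, hC, hdecay⟩ := exists_decay h0 h1 hN hs hden
  -- `θ ^ m ≤ l ^ (g m)`, which compares the gain in sparseness with the scale of the decay
  obtain ⟨g, hg⟩ := pow_unbounded_of_one_lt θ hl1
  set β : ℝ := θ * l with hβ
  have hβl : (l : ℝ) ≤ β := le_mul_of_one_le_left (by positivity) hθ.le
  have hβ1 : 1 < β := hl1.trans_le hβl
  let S : ℕ → Set Λ := fun n => {x | |(x : ℝ)| < c * β ^ n / 2}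
  have hSmono : Monotone S := by
    intro m n hmn x hx
    change |(x : ℝ)| < c * β ^ m / 2 at hx
    refine lt_of_lt_of_le hx ?_
    have := pow_le_pow_right₀ hβ1.le hmn
    gcongr
  have hSlevel : ∀ n, ∀ x ∈ S n, ∀ y ∈ S n, x ≠ y →
      ∃ k ≤ n, IsLevel ρ N k ((x : ℝ) - y) := by
    intro n x hx y hy hxy
    have hxy' : (x : ℝ) ≠ y := fun he => hxy (Subtype.ext he)
    obtain ⟨k, hk⟩ := h.exists_isLevel h0 h1 hN x.2 y.2 hxy'
    refine ⟨k, ?_, hk⟩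
    have e1 := hgrow x x.2 y y.2 hxy' k hk
    have e2 : |(x : ℝ) - y| < c * β ^ n := by
      have := abs_sub (x : ℝ) y
      change |(x : ℝ)| < _ at hx
      change |(y : ℝ)| < _ at hy
      linarith
    exact ((pow_lt_pow_iff_right₀ hβ1).1 (lt_of_mul_lt_mul_left (e1.trans_lt e2) hc.le)).le
  obtain ⟨j₁, hj₁⟩ := pow_unbounded_of_one_lt (4 / c) hl1
  obtain ⟨A, hA⟩ : ∃ A, A = 2 * g + 1 := ⟨_, rfl⟩
  -- frequencies outside `S n` stay far from `0` after scaling by `ρ ^ (n + C ^ j)`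
  have hstep : ∀ ξ : ℝ, |ξ| ≤ 1 → ∀ j, j₁ ≤ j → ∀ n, A * C ^ j ≤ n →
      (1 - κ ^ j) * (1 - parsevalMass ρ N ξ (S n)) ≤
        1 - parsevalMass ρ N ξ (S (n + C ^ j)) := by
    intro ξ hξ j hj n hn
    refine h.mass_step h0 h1 hN (hSmono (Nat.le_add_right _ _)) (hSlevel _)
      (by positivity) fun x _ hxS => ?_
    have hCj : j ≤ C ^ j := (Nat.lt_pow_self (by omega)).le
    have hlC : 4 / c ≤ (l : ℝ) ^ C ^ j :=
      hj₁.le.trans (pow_le_pow_right₀ hl1.le (hj.trans hCj))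
    have hln : (θ ^ C ^ j) ^ 2 * (4 / c) ≤ (l : ℝ) ^ n := by
      calc (θ ^ C ^ j) ^ 2 * (4 / c) ≤ (((l : ℝ) ^ g) ^ C ^ j) ^ 2 * (l : ℝ) ^ C ^ j := by
            gcongr
        _ = (l : ℝ) ^ (A * C ^ j) := by
            rw [← pow_mul, ← pow_mul, ← pow_add]; congr 1; rw [hA]; ring
        _ ≤ _ := pow_le_pow_right₀ hl1.le hn
    have hx : c * β ^ n / 2 ≤ |(x : ℝ)| := not_lt.1 hxS
    have hCn : C ^ j ≤ n := (Nat.le_mul_of_pos_left _ (by omega)).trans hn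
    have hβn : 4 ≤ c * β ^ n := by
      have e1 : 4 / c ≤ β ^ n := hlC.trans ((pow_le_pow_right₀ hl1.le hCn).trans
        (pow_le_pow_left₀ (by positivity) hβl n))
      rw [div_le_iff₀ hc] at e1
      linarith
    have hxξ : c * β ^ n / 4 ≤ |ξ + x| := by
      have := abs_sub (ξ + x) ξ
      rw [add_sub_cancel_left] at this
      linarith
    have hy : θ ^ C ^ j ≤ |ρ ^ (n + C ^ j) * (ξ + x)| := by
      have e0 : ρ ^ (n + C ^ j) = (θ ^ (n + C ^ j))⁻¹ := by rw [hθdef, inv_pow, inv_inv]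
      rw [abs_mul, abs_of_pos (by positivity), e0, ← div_eq_inv_mul, le_div_iff₀ (by positivity)]
      refine le_trans ?_ hxξ
      rw [hβ, mul_pow, pow_add]
      have e1 : (θ ^ C ^ j) ^ 2 ≤ c * (l : ℝ) ^ n / 4 := by
        have e2 := mul_le_mul_of_nonneg_left hln hc.le
        have e3 : c * ((θ ^ C ^ j) ^ 2 * (4 / c)) = 4 * (θ ^ C ^ j) ^ 2 := by field_simp
        rw [e3] at e2
        linarith
      have e4 : 0 < θ ^ n := by positivity
      nlinarith [mul_le_mul_of_nonneg_left e1 e4.le]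
    have hF := hdecay j _ hy
    have hκj : κ ^ j ≤ 1 := pow_le_one₀ hκ0.le hκ1.le
    calc _ ≤ (κ ^ j) ^ 2 := pow_le_pow_left₀ (norm_nonneg _) hF 2
      _ ≤ κ ^ j := by nlinarith [pow_pos hκ0 j]
  -- the steps from `A * C ^ j` to `A * C ^ (j + 1)`
  obtain ⟨H, hH⟩ : ∃ H, H = (C - 1) * A := ⟨_, rfl⟩
  have hblock : ∀ ξ : ℝ, |ξ| ≤ 1 → ∀ j, j₁ ≤ j →
      (1 - H * κ ^ j) * (1 - parsevalMass ρ N ξ (S (A * C ^ j))) ≤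
        1 - parsevalMass ρ N ξ (S (A * C ^ (j + 1))) := by
    intro ξ hξ j hj
    have hκj : κ ^ j ≤ 1 := pow_le_one₀ hκ0.le hκ1.le
    have hiter : ∀ i : ℕ, (1 - κ ^ j) ^ i * (1 - parsevalMass ρ N ξ (S (A * C ^ j))) ≤
        1 - parsevalMass ρ N ξ (S (A * C ^ j + i * C ^ j)) := by
      intro i
      induction i with
      | zero => simp
      | succ i ih =>
        have e1 := hstep ξ hξ j hj (A * C ^ j + i * C ^ j) (Nat.le_add_right _ _)
        have e2 := mul_le_mul_of_nonneg_left ih (by linarith : 0 ≤ 1 - κ ^ j)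
        rw [show A * C ^ j + (i + 1) * C ^ j = A * C ^ j + i * C ^ j + C ^ j by ring, pow_succ']
        linarith
    have e3 := hiter H
    have e4 : A * C ^ j + H * C ^ j = A * C ^ (j + 1) := by
      obtain ⟨D, rfl⟩ : ∃ D, C = D + 1 := ⟨C - 1, by omega⟩
      rw [hH, Nat.add_sub_cancel, pow_succ]
      ring
    rw [e4] at e3
    have e5 : 1 - H * κ ^ j ≤ (1 - κ ^ j) ^ H := by
      have := one_add_mul_le_pow (a := -κ ^ j) (by linarith) H
      calc 1 - H * κ ^ j = 1 + H * (-κ ^ j) := by ring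
        _ ≤ (1 + -κ ^ j) ^ H := this
        _ = _ := by rw [← sub_eq_add_neg]
    exact (mul_le_mul_of_nonneg_right e5 (by linarith [h.parsevalMass_le_one ξ (S (A * C ^ j))])).trans e3
  have hCpow : StrictMono fun j => A * C ^ j := fun i j hij =>
    Nat.mul_lt_mul_of_pos_left (Nat.pow_lt_pow_right (by omega) hij) (by omega)
  refine ⟨fun j => S (A * C ^ j), κ, H, j₁, hSmono.comp hCpow.monotone, fun x => ?_, fun n => ?_,
    hκ0, hκ1, hblock⟩
  · have htend : Tendsto (fun j : ℕ => c * β ^ j / 2) atTop atTop :=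
      ((tendsto_pow_atTop_atTop_of_one_lt hβ1).const_mul_atTop hc).atTop_div_const two_pos
    obtain ⟨j, hj⟩ := (htend.eventually_gt_atTop |(x : ℝ)|).exists
    exact ⟨j, hSmono (hCpow.le_apply (x := j)) hj⟩
  · obtain ⟨x, hx, y, hy, -, hlt⟩ := h.exists_lt_dist h0 h1 hN (c * β ^ (A * C ^ n))
    by_contra! hall
    have e1 : |x| < c * β ^ (A * C ^ n) / 2 := hall ⟨x, hx⟩
    have e2 : |y| < c * β ^ (A * C ^ n) / 2 := hall ⟨y, hy⟩
    have := abs_sub x y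
    linarith

/-- A positive part of Parseval's sum is lost, since the product of the factors `1 - H κ ^ j`
converges. -/
theorem IsParsevalSet.den_eq_one (h0 : 0 < ρ) (h1 : ρ < 1) (hN : 1 < N)
    (h : IsParsevalSet ρ N Λ) {s : ℚ} (hs : ρ⁻¹ = s) : s.den = 1 := by
  by_contra hden1
  obtain ⟨S, κ, H, j₁, hSmono, hScov, hSne, hκ0, hκ1, hblock⟩ :=
    h.exists_exhaustion h0 h1 hN hs hden1
  have hκ : 0 < 1 - κ := sub_pos.2 hκ1
  obtain ⟨j₂, hj₂⟩ := exists_pow_lt_of_lt_one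
    (show 0 < (1 - κ) / 2 / (H + 1) by positivity) hκ1
  obtain ⟨j₀, hj₀, hj₀'⟩ : ∃ j₀, j₁ ≤ j₀ ∧ j₂ ≤ j₀ := ⟨_, le_max_left _ _, le_max_right _ _⟩
  have hHκ : H * κ ^ j₀ ≤ (1 - κ) / 2 := by
    have e1 : κ ^ j₀ ≤ (1 - κ) / 2 / (H + 1) :=
      (pow_le_pow_of_le_one hκ0.le hκ1.le hj₀').trans hj₂.le
    rw [le_div_iff₀ (by positivity)] at e1
    nlinarith [pow_pos hκ0 j₀]
  -- a frequency outside `S j₀` and a point `ξ` seeing it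
  obtain ⟨x₁, hx₁⟩ := hSne j₀
  obtain ⟨ξ, hξ, hξx⟩ : ∃ ξ : ℝ, |ξ| ≤ 1 ∧ fourierSelfSimilar ρ N (ξ + x₁) ≠ 0 := by
    obtain ⟨z, hz1, hz2, hz3⟩ := ((countable_zeros h0 h1 (by omega : 0 < N)).dense_compl
      ℝ).exists_between (show (x₁ : ℝ) - 1 < x₁ + 1 by linarith)
    refine ⟨z - x₁, abs_le.2 ⟨by linarith, by linarith⟩, ?_⟩
    rw [sub_add_cancel]
    exact hz1
  have hpos : 0 < 1 - parsevalMass ρ N ξ (S j₀) := by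
    have e1 := ((h.2 ξ).summable.indicator (S j₀)).tsum_lt_tsum (i := x₁)
      (fun l => Set.indicator_le_self' (fun _ _ => sq_nonneg _) l)
      (by rw [Set.indicator_of_notMem hx₁]; exact pow_pos (norm_pos_iff.2 hξx) 2)
      (h.2 ξ).summable
    rw [(h.2 ξ).tsum_eq] at e1
    exact sub_pos.2 e1
  have hhalf := half_le_of_geometric_decay
    (x := fun j => 1 - parsevalMass ρ N ξ (S (j₀ + j))) (ε := fun j => H * κ ^ (j₀ + j))
    hpos.le (fun j => mul_nonneg (Nat.cast_nonneg H) (pow_nonneg hκ0.le _)) (fun j => by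
      have e1 : ∑ i ∈ Finset.range j, (H : ℝ) * κ ^ (j₀ + i) =
          H * κ ^ j₀ * ∑ i ∈ Finset.range j, κ ^ i := by
        rw [Finset.mul_sum]
        exact Finset.sum_congr rfl fun i _ => by rw [pow_add]; ring
      have e2 : ∑ i ∈ Finset.range j, κ ^ i ≤ (1 - κ)⁻¹ := by
        rw [← tsum_geometric_of_lt_one hκ0.le hκ1]
        exact (summable_geometric_of_lt_one hκ0.le hκ1).sum_le_tsum _
          fun _ _ => pow_nonneg hκ0.le _
      rw [e1]
      calc _ ≤ (1 - κ) / 2 * (1 - κ)⁻¹ :=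
            mul_le_mul hHκ e2 (Finset.sum_nonneg fun _ _ => pow_nonneg hκ0.le _) (by positivity)
        _ = 1 / 2 := by field_simp)
    (fun j => hblock ξ hξ (j₀ + j) (hj₀.trans (Nat.le_add_right _ _)))
  -- but the remainders tend to zero
  obtain ⟨η, hη⟩ : ∃ η, η = (1 - parsevalMass ρ N ξ (S j₀)) / 2 := ⟨_, rfl⟩
  have hη0 : 0 < η := hη ▸ half_pos hpos
  obtain ⟨T, hT⟩ := ((h.2 ξ).eventually (lt_mem_nhds (show 1 - η < 1 by linarith))).exists
  choose n hn using hScov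
  have hTS : ∀ x ∈ T, x ∈ S (j₀ + T.sup n) := fun x hx =>
    hSmono ((Finset.le_sup hx).trans (Nat.le_add_left _ _)) (hn x)
  have e1 : ∑ x ∈ T, ‖fourierSelfSimilar ρ N (ξ + x)‖ ^ 2 ≤
      parsevalMass ρ N ξ (S (j₀ + T.sup n)) := by
    refine le_trans (le_of_eq ?_) (((h.2 ξ).summable.indicator _).sum_le_tsum T
      fun l _ => Set.indicator_nonneg (fun _ _ => sq_nonneg _) l)
    exact Finset.sum_congr rfl fun x hx => (Set.indicator_of_mem (hTS x hx)
      fun l : Λ => ‖fourierSelfSimilar ρ N (ξ + l)‖ ^ 2).symm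
  have e2 := hhalf (T.sup n)
  simp only [add_zero] at e2
  linarith

end

/-! ### Completeness of exponentials -/

/-- A real integrable function is determined by its Fourier transform: its positive and negative
parts are densities of finite measures with the same characteristic function. -/
theorem ae_eq_zero_of_integral_expChar_real {μ : Measure ℝ} [IsFiniteMeasure μ] {g : ℝ → ℝ}
    (hg : Integrable g μ) (h : ∀ t : ℝ, ∫ x, expChar (t * x) * (g x : ℂ) ∂μ = 0) : g =ᵐ[μ] 0 := by
  let p : (ℝ → ℝ) → ℝ → ENNReal := fun u x => ENNReal.ofReal (u x)
  have hfin : ∀ u : ℝ → ℝ, Integrable u μ → IsFiniteMeasure (μ.withDensity (p u)) := fun u hu =>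
    isFiniteMeasure_withDensity_ofReal hu.2
  have hneg : Integrable (fun x => -g x) μ := hg.neg
  have := hfin _ hg
  have := hfin _ hneg
  have hchar : ∀ (u : ℝ → ℝ), Integrable u μ → ∀ t : ℝ, charFun (μ.withDensity (p u)) t =
      ∫ x, expChar (t / (2 * Real.pi) * x) * ((max (u x) 0 : ℝ) : ℂ) ∂μ := by
    intro u hu t
    rw [charFun_apply_real, integral_withDensity_eq_integral_toReal_smul₀
      hu.aemeasurable.ennreal_ofReal (ae_of_all _ fun x => ENNReal.ofReal_lt_top)]
    refine integral_congr_ae (ae_of_all _ fun x => ?_)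
    simp only [ENNReal.toReal_ofReal', Complex.real_smul]
    rw [mul_comm, expChar]
    congr 2
    have : (Real.pi : ℂ) ≠ 0 := by exact_mod_cast Real.pi_ne_zero
    push_cast
    field_simp
  have hint : ∀ (u : ℝ → ℝ), Integrable u μ → ∀ t : ℝ,
      Integrable (fun x => expChar (t * x) * ((max (u x) 0 : ℝ) : ℂ)) μ := by
    intro u hu t
    refine Integrable.bdd_mul (c := 1) hu.pos_part.ofReal ?_ (ae_of_all _ fun x =>
      (norm_expChar _).le)
    exact (continuous_expChar.comp (by fun_prop)).aestronglyMeasurable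
  have heq : μ.withDensity (p g) = μ.withDensity (p fun x => -g x) := by
    refine Measure.ext_of_charFun (funext fun t => ?_)
    rw [hchar g hg, hchar _ hneg, ← sub_eq_zero, ← integral_sub (hint g hg _) (hint _ hneg _),
      ← h (t / (2 * Real.pi))]
    refine integral_congr_ae (ae_of_all _ fun x => ?_)
    simp only
    rw [← mul_sub, ← Complex.ofReal_sub]
    congr 2
    rcases le_total (g x) 0 with hx | hx
    · rw [max_eq_right hx, max_eq_left (by linarith)]; ring
    · rw [max_eq_left hx, max_eq_right (by linarith)]; ring
  have hae := (withDensity_eq_iff hg.aemeasurable.ennreal_ofReal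
    hneg.aemeasurable.ennreal_ofReal hg.lintegral_lt_top.ne).1 heq
  filter_upwards [hae] with x hx
  change ENNReal.ofReal (g x) = ENNReal.ofReal (-g x) at hx
  rcases le_total (g x) 0 with hx0 | hx0
  · rw [ENNReal.ofReal_of_nonpos hx0, eq_comm, ENNReal.ofReal_eq_zero] at hx
    simp only [Pi.zero_apply]; linarith
  · rw [ENNReal.ofReal_of_nonpos (by linarith : -g x ≤ 0), ENNReal.ofReal_eq_zero] at hx
    simp only [Pi.zero_apply]; linarith

theorem ae_eq_zero_of_integral_expChar {μ : Measure ℝ} [IsFiniteMeasure μ] {f : ℝ → ℂ}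
    (hf : Integrable f μ) (h : ∀ t : ℝ, ∫ x, expChar (t * x) * f x ∂μ = 0) : f =ᵐ[μ] 0 := by
  have hint : ∀ (u : ℝ → ℂ), Integrable u μ → ∀ t : ℝ,
      Integrable (fun x => expChar (t * x) * u x) μ := by
    intro u hu t
    refine Integrable.bdd_mul (c := 1) hu ?_ (ae_of_all _ fun x => (norm_expChar _).le)
    exact (continuous_expChar.comp (by fun_prop)).aestronglyMeasurable
  have hconj : ∀ t : ℝ, ∫ x, expChar (t * x) * (starRingEnd ℂ) (f x) ∂μ = 0 := by
    intro t
    have h1 := congrArg (starRingEnd ℂ) (h (-t))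
    rw [← integral_conj, map_zero] at h1
    rw [← h1]
    refine integral_congr_ae (ae_of_all _ fun x => ?_)
    simp only [map_mul, conj_expChar]
    congr 2
    ring
  have hfc : Integrable (fun x => (starRingEnd ℂ) (f x)) μ := by
    refine ⟨Complex.continuous_conj.comp_aestronglyMeasurable hf.1, ?_⟩
    simpa [HasFiniteIntegral] using hf.2
  have hre : (fun x => (f x).re) =ᵐ[μ] 0 := by
    refine ae_eq_zero_of_integral_expChar_real hf.re fun t => ?_
    have h1 := integral_add (hint _ hf t) (hint _ hfc t)
    rw [h, hconj, add_zero] at h1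
    have h2 : ∫ x, 2 * (expChar (t * x) * ((f x).re : ℂ)) ∂μ = 0 := by
      rw [← h1]
      refine integral_congr_ae (ae_of_all _ fun x => ?_)
      simp only
      rw [← mul_add, Complex.add_conj]
      push_cast; ring
    rw [integral_const_mul] at h2
    exact (mul_eq_zero.1 h2).resolve_left two_ne_zero
  have him : (fun x => (f x).im) =ᵐ[μ] 0 := by
    refine ae_eq_zero_of_integral_expChar_real hf.im fun t => ?_
    have h1 := integral_sub (hint _ hf t) (hint _ hfc t)
    rw [h, hconj, sub_zero] at h1
    have h2 : ∫ x, (2 * Complex.I) * (expChar (t * x) * ((f x).im : ℂ)) ∂μ = 0 := by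
      rw [← h1]
      refine integral_congr_ae (ae_of_all _ fun x => ?_)
      simp only
      rw [← mul_sub, Complex.sub_conj]
      push_cast; ring
    rw [integral_const_mul] at h2
    exact (mul_eq_zero.1 h2).resolve_left (mul_ne_zero two_ne_zero Complex.I_ne_zero)
  filter_upwards [hre, him] with x h1 h2
  exact Complex.ext h1 h2

theorem eq_zero_of_inner_expLp {μ : Measure ℝ} [IsFiniteMeasure μ] {f : Lp ℂ 2 μ}
    (h : ∀ t, inner ℂ (expLp μ t) f = 0) : f = 0 := by
  have hf : Integrable f μ := (Lp.memLp f).integrable one_le_two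
  refine (Lp.eq_zero_iff_ae_eq_zero).2 (ae_eq_zero_of_integral_expChar hf fun t => ?_)
  rw [← h t, L2.inner_def]
  refine integral_congr_ae ?_
  filter_upwards [(memLp_expChar μ t).coeFn_toLp] with x hx
  rw [expLp, hx, RCLike.inner_apply, conj_expChar, neg_neg, mul_comm]

section
variable {ρ : ℝ} {N : ℕ} {Λ : Set ℝ}

/-- If Parseval's identity holds for every exponential, a vector orthogonal to the exponentials
with frequencies in `Λ` is orthogonal to all exponentials, by Bessel's inequality for the
orthonormal family enlarged by that vector. Hence it is zero. -/
theorem IsParsevalSet.isSpectrum (h0 : 0 < ρ) (h1 : ρ < 1) (hN : 0 < N)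
    (h : IsParsevalSet ρ N Λ) (hΛ : Λ.Countable) : IsSpectrum (selfSimilarMeasure ρ N) Λ := by
  classical
  have := isProbabilityMeasure_selfSimilarMeasure h0 h1 hN
  set μ := selfSimilarMeasure ρ N with hμ
  let v : Λ → Lp ℂ 2 μ := fun l => expLp μ l
  have hv : Orthonormal ℂ v := by
    refine ⟨fun l => norm_expLp μ l, fun l l' hll => ?_⟩
    change inner ℂ (expLp μ l) (expLp μ l') = 0
    rw [inner_expLp_selfSimilar]
    exact h.1 l l.2 l' l'.2 fun he => hll (Subtype.ext he)
  have hspan : (Submodule.span ℂ (Set.range v))ᗮ = ⊥ := by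
    rw [Submodule.eq_bot_iff]
    intro f hf
    have hfv : ∀ l, inner ℂ (v l) f = 0 := fun l =>
      Submodule.inner_right_of_mem_orthogonal (Submodule.subset_span (Set.mem_range_self l)) hf
    by_contra hf0
    have hnf : ‖f‖ ≠ 0 := norm_ne_zero_iff.2 hf0
    apply hf0
    refine eq_zero_of_inner_expLp (μ := μ) fun t => ?_
    -- Bessel's inequality for `v` enlarged by the normalization of `f`
    let f' : Lp ℂ 2 μ := ((‖f‖ : ℂ)⁻¹) • f
    let w : Option Λ → Lp ℂ 2 μ := fun o => o.elim f' v
    have hw : Orthonormal ℂ w := by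
      constructor
      · rintro (_ | l)
        · change ‖f'‖ = 1
          rw [norm_smul, norm_inv, Complex.norm_real, norm_norm, inv_mul_cancel₀ hnf]
        · exact hv.1 l
      · rintro (_ | l) (_ | l') hne
        · exact absurd rfl hne
        · change inner ℂ f' (v l') = 0
          rw [inner_smul_left, inner_eq_zero_symm.1 (hfv l'), mul_zero]
        · change inner ℂ (v l) f' = 0
          rw [inner_smul_right, hfv l, mul_zero]
        · exact hv.2 fun he => hne (by rw [he])
    have hb : ∀ s : Finset Λ, ∑ l ∈ s, ‖fourierSelfSimilar ρ N (-t + l)‖ ^ 2 ≤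
        1 - ‖(inner ℂ f' (expLp μ t) : ℂ)‖ ^ 2 := by
      intro s
      have h2 := hw.sum_inner_products_le (expLp μ t) (s := s.insertNone)
      rw [Finset.sum_insertNone, norm_expLp] at h2
      have h3 : ∑ l ∈ s, ‖fourierSelfSimilar ρ N (-t + l)‖ ^ 2 =
          ∑ l ∈ s, ‖(inner ℂ (w (some l)) (expLp μ t) : ℂ)‖ ^ 2 := by
        refine Finset.sum_congr rfl fun l _ => ?_
        change _ = ‖(inner ℂ (expLp μ l) (expLp μ t) : ℂ)‖ ^ 2
        rw [inner_expLp_selfSimilar, neg_add_eq_sub]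
      have h4 : w none = f' := rfl
      rw [h4] at h2
      rw [h3]
      linarith
    have h5 := le_of_tendsto' (h.2 (-t)) hb
    have h6 : (inner ℂ f' (expLp μ t) : ℂ) = 0 := by
      rw [← norm_eq_zero]
      nlinarith [norm_nonneg (inner ℂ f' (expLp μ t) : ℂ)]
    rw [inner_eq_zero_symm] at h6
    change inner ℂ (expLp μ t) (((‖f‖ : ℂ)⁻¹) • f) = 0 at h6
    rw [inner_smul_right, mul_eq_zero] at h6
    refine h6.resolve_left ?_
    simpa using hnf
  refine ⟨hΛ, HilbertBasis.mkOfOrthogonalEqBot hv hspan, fun l => ?_⟩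
  rw [HilbertBasis.coe_mkOfOrthogonalEqBot]
  filter_upwards [(memLp_expChar μ l).coeFn_toLp] with x hx
  change (expLp μ l : ℝ → ℂ) x = _
  rw [expLp, hx, expFun_eq]

end

/-! ### A spectrum for integer reciprocal ratios divisible by the digit number -/

/-- Parseval's identity for the uniform measure on `{0, …, N - 1}` and the frequencies `d / N`, or
`-d / N`, with `d < N`. -/
theorem sum_norm_sq_expMean {N : ℕ} (hN : 0 < N) (x : ℝ) {ε : ℤ} (hε : IsUnit ε) :
    ∑ d ∈ Finset.range N, ‖expMean N (x + ε * d / N)‖ ^ 2 = 1 := by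
  have hNC : (N : ℂ) ≠ 0 := by exact_mod_cast hN.ne'
  have hNR : (N : ℝ) ≠ 0 := by exact_mod_cast hN.ne'
  have hterm : ∀ d : ℕ, ((‖expMean N (x + ε * d / N)‖ ^ 2 : ℝ) : ℂ) =
      (N : ℂ)⁻¹ * (N : ℂ)⁻¹ * ∑ i ∈ Finset.range N, ∑ j ∈ Finset.range N,
        expChar ((i - j) * x) * expChar (d * (ε * (i - j) / N)) := by
    intro d
    rw [Complex.ofReal_pow, ← Complex.mul_conj', expMean, map_mul, map_inv₀, Complex.conj_natCast,
      map_sum, mul_mul_mul_comm, Finset.sum_mul_sum]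
    congr 1
    refine Finset.sum_congr rfl fun i _ => Finset.sum_congr rfl fun j _ => ?_
    rw [conj_expChar, ← expChar_add, ← expChar_add]
    congr 1
    field_simp
    ring
  have hinner : ∀ i ∈ Finset.range N, ∀ j ∈ Finset.range N,
      ∑ d ∈ Finset.range N, expChar (d * (ε * (i - j) / N)) = if i = j then (N : ℂ) else 0 := by
    intro i hi j hj
    rw [Finset.mem_range] at hi hj
    split_ifs with hij
    · simp [hij, expChar_zero]
    · have h1 : expMean N (ε * (i - j) / N) = 0 := by
        rw [expMean_eq_zero_iff hN]
        refine ⟨ε * ((i : ℤ) - j), by push_cast; field_simp, fun hd => hij ?_⟩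
        have h2 : (N : ℤ) ∣ (i : ℤ) - j := by
          rwa [mul_comm, hε.dvd_mul_right] at hd
        have h3 := Int.eq_zero_of_abs_lt_dvd h2 (by rw [abs_lt]; constructor <;> omega)
        omega
      rw [expMean, mul_eq_zero] at h1
      exact h1.resolve_left (inv_ne_zero hNC)
  have h2 : ((∑ d ∈ Finset.range N, ‖expMean N (x + ε * d / N)‖ ^ 2 : ℝ) : ℂ) = 1 := by
    rw [Complex.ofReal_sum, Finset.sum_congr rfl fun d _ => hterm d, ← Finset.mul_sum,
      Finset.sum_comm]
    have h3 : ∀ i ∈ Finset.range N, ∑ d ∈ Finset.range N, ∑ j ∈ Finset.range N,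
        expChar ((i - j) * x) * expChar (d * (ε * (i - j) / N)) = N := by
      intro i hi
      rw [Finset.sum_comm]
      simp only [← Finset.mul_sum]
      rw [Finset.sum_congr rfl fun j hj => by rw [hinner i hi j hj]]
      rw [Finset.sum_eq_single_of_mem i hi fun j _ hji => by rw [if_neg hji.symm, mul_zero]]
      simp [expChar_zero]
    rw [Finset.sum_congr rfl h3, Finset.sum_const, Finset.card_range, nsmul_eq_mul]
    field_simp
  exact_mod_cast h2

/-- The partial spectra `{∑_{k < n} (-1) ^ k r q ^ k d_k : d_k < N}`, where `q = N r`. The signs keep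
the sums, divided by `q ^ n`, in a fixed compact subset of `(-1, 1)`, also for `r = 1`. -/
noncomputable def partialSpectrum (N r : ℕ) : ℕ → Finset ℝ
  | 0 => {0}
  | n + 1 => (partialSpectrum N r n ×ˢ Finset.range N).image fun p =>
      p.1 + ((((-1) ^ n * r * (N * r) ^ n : ℤ) * p.2 : ℤ) : ℝ)

section
variable {N r : ℕ}

/-- The product of the first `n` factors of the Fourier transform of `μ_{1/q,N}`. -/
noncomputable def partialTransform (N q n : ℕ) (t : ℝ) : ℂ :=
  ∏ k ∈ Finset.Icc 1 n, expMean N ((q : ℝ)⁻¹ ^ k * t)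

theorem partialTransform_zero (hN : 0 < N) (q n : ℕ) : partialTransform N q n 0 = 1 := by
  simp [partialTransform, expMean_zero hN]

theorem partialTransform_add (q : ℕ) (hq : 0 < q) (n : ℕ) (a : ℤ) (t : ℝ) :
    partialTransform N q n (t + ((q ^ n * a : ℤ) : ℝ)) = partialTransform N q n t := by
  refine Finset.prod_congr rfl fun k hk => ?_
  have hkn := (Finset.mem_Icc.1 hk).2
  have hqR : (q : ℝ) ≠ 0 := by exact_mod_cast hq.ne'
  have : (q : ℝ)⁻¹ ^ k * (t + ((q ^ n * a : ℤ) : ℝ)) =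
      (q : ℝ)⁻¹ ^ k * t + ((q ^ (n - k) * a : ℤ) : ℝ) := by
    have h1 : (q : ℝ) ^ n = (q : ℝ) ^ k * (q : ℝ) ^ (n - k) := by
      rw [← pow_add, Nat.add_sub_cancel' hkn]
    push_cast
    rw [h1, mul_add, inv_pow]
    field_simp
  rw [this, expMean_add_intCast]

theorem partialTransform_succ (q n : ℕ) (t : ℝ) : partialTransform N q (n + 1) t =
    partialTransform N q n t * expMean N ((q : ℝ)⁻¹ ^ (n + 1) * t) := by
  rw [partialTransform, Finset.prod_Icc_succ_top (by omega)]
  rfl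

theorem partialTransform_sub_eq_zero (hN : 0 < N) {q n : ℕ} {F : Finset ℝ}
    (hF : ∀ ξ, ∑ x ∈ F, ‖partialTransform N q n (ξ + x)‖ ^ 2 = 1) {x y : ℝ} (hx : x ∈ F)
    (hy : y ∈ F) (hxy : x ≠ y) : partialTransform N q n (x - y) = 0 := by
  have h1 := hF (-y)
  rw [← Finset.add_sum_erase _ _ hy, neg_add_cancel, partialTransform_zero hN, norm_one, one_pow,
    add_eq_left, Finset.sum_eq_zero_iff_of_nonneg fun _ _ => by positivity] at h1
  have h2 := h1 x (Finset.mem_erase.2 ⟨hxy, hx⟩)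
  rwa [neg_add_eq_sub, sq_eq_zero_iff, norm_eq_zero] at h2

/-- Parseval's identity on the `n`-th partial spectrum for the convolution of the first `n` scaled
digit laws. In the step from `n` to `n + 1` the new frequencies are periods of the old factors, and
the sum over the new digit is `1` by `sum_norm_sq_expMean`. -/
theorem sum_partialSpectrum (hN : 0 < N) (hr : 0 < r) (n : ℕ) : ∀ ξ,
    ∑ x ∈ partialSpectrum N r n, ‖partialTransform N (N * r) n (ξ + x)‖ ^ 2 = 1 := by
  classical
  induction n with
  | zero => intro ξ; simp [partialSpectrum, partialTransform]
  | succ n ih =>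
    intro ξ
    have hq : 0 < N * r := Nat.mul_pos hN hr
    have hNR : (N : ℝ) ≠ 0 := by exact_mod_cast hN.ne'
    have hrR : (r : ℝ) ≠ 0 := by exact_mod_cast hr.ne'
    have hshift : ∀ (d : ℤ) (t : ℝ), partialTransform N (N * r) n
        (t + ((((-1) ^ n * r * (N * r) ^ n : ℤ) * d : ℤ) : ℝ)) =
          partialTransform N (N * r) n t := by
      intro d t
      rw [← partialTransform_add (N * r) hq n ((-1) ^ n * r * d) t]
      congr 2
      push_cast
      ring
    have hinj : Set.InjOn (fun p : ℝ × ℕ =>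
        p.1 + ((((-1) ^ n * r * (N * r) ^ n : ℤ) * p.2 : ℤ) : ℝ))
        (partialSpectrum N r n ×ˢ Finset.range N : Finset (ℝ × ℕ)) := by
      rintro ⟨x, d⟩ hp ⟨y, e⟩ hp' heq
      simp only [Finset.coe_product, Set.mem_prod, Finset.mem_coe] at hp hp'
      simp only at heq
      have hxy : x = y := by
        by_contra hne
        have h1 := partialTransform_sub_eq_zero hN ih hp.1 hp'.1 hne
        have h2 : x - y = 0 + ((((-1) ^ n * r * (N * r) ^ n : ℤ) * ((e : ℤ) - d) : ℤ) : ℝ) := by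
          push_cast at heq ⊢
          linear_combination heq
        rw [h2, hshift, partialTransform_zero hN] at h1
        exact one_ne_zero h1
      subst hxy
      have h3 := add_left_cancel heq
      have h4 : ((-1) ^ n * r * (N * r) ^ n : ℤ) ≠ 0 := by
        have hrZ : (r : ℤ) ≠ 0 := by exact_mod_cast hr.ne'
        have hNZ : (N : ℤ) ≠ 0 := by exact_mod_cast hN.ne'
        exact mul_ne_zero (mul_ne_zero (pow_ne_zero _ (by norm_num)) hrZ)
          (pow_ne_zero _ (mul_ne_zero hNZ hrZ))
      have h5 := mul_left_cancel₀ h4 (Int.cast_injective h3)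
      have h6 : d = e := by exact_mod_cast h5
      rw [h6]
    rw [partialSpectrum, Finset.sum_image hinj, Finset.sum_product, ← ih ξ]
    refine Finset.sum_congr rfl fun x _ => ?_
    have hε : IsUnit ((-1 : ℤ) ^ n) := (isUnit_neg_one).pow n
    rw [← mul_one (‖partialTransform N (N * r) n (ξ + x)‖ ^ 2),
      ← sum_norm_sq_expMean hN (((N * r : ℕ) : ℝ)⁻¹ ^ (n + 1) * (ξ + x)) hε, Finset.mul_sum]
    refine Finset.sum_congr rfl fun d _ => ?_
    rw [partialTransform_succ, ← add_assoc, hshift, norm_mul, mul_pow]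
    congr 4
    push_cast
    rw [mul_add, pow_succ, inv_pow, mul_pow]
    field_simp

/-- Divided by `(-q) ^ n`, where `q = N r`, the `n`-th partial spectrum lies in
`[-q / (q + 1), 1 / (q + 1)]`. -/
theorem partialSpectrum_bounds (hN : 0 < N) (hr : 0 < r) (n : ℕ) :
    ∀ x ∈ partialSpectrum N r n,
      -((N * r : ℝ) * (N * r) ^ n) ≤ (N * r + 1) * ((-1) ^ n * x) ∧
        (N * r + 1) * ((-1) ^ n * x) ≤ (N * r : ℝ) ^ n := by
  classical
  induction n with
  | zero =>
    intro x hx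
    rw [partialSpectrum, Finset.mem_singleton] at hx
    subst hx
    simp only [pow_zero, mul_zero]
    constructor
    · have : (0 : ℝ) ≤ N * r := by positivity
      linarith
    · exact zero_le_one
  | succ n ih =>
    intro y hy
    rw [partialSpectrum, Finset.mem_image] at hy
    obtain ⟨⟨x, d⟩, hp, rfl⟩ := hy
    rw [Finset.mem_product, Finset.mem_range] at hp
    obtain ⟨h1, h2⟩ := ih x hp.1
    have hd : (d : ℝ) + 1 ≤ N := by exact_mod_cast hp.2
    have hr1 : (1 : ℝ) ≤ r := by exact_mod_cast hr
    obtain ⟨Q, hQ⟩ : ∃ Q : ℝ, Q = (N * r : ℝ) ^ n := ⟨_, rfl⟩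
    have hQ0 : 0 ≤ Q := by rw [hQ]; positivity
    have hsq : ((-1 : ℝ) ^ n) * (-1) ^ n = 1 := by
      rw [← mul_pow]; norm_num
    have hval : ((-1 : ℝ) ^ (n + 1)) *
        (x + ((((-1) ^ n * r * (N * r) ^ n : ℤ) * (d : ℤ) : ℤ) : ℝ)) =
          -((-1) ^ n * x) - r * Q * d := by
      rw [hQ]
      push_cast
      rw [pow_succ]
      linear_combination -(r : ℝ) * (N * r) ^ n * d * hsq
    simp only
    rw [hval, pow_succ (N * r : ℝ) n, ← hQ]
    rw [← hQ] at h1 h2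
    have hrd0 : (0 : ℝ) ≤ r * d := by positivity
    have hrd : (r : ℝ) * d ≤ N * r - 1 := by nlinarith
    have hq0 : (0 : ℝ) ≤ N * r := by positivity
    constructor
    · have h3 : (N * r + 1) * (Q * (r * d)) ≤ (N * r + 1) * (Q * (N * r - 1 : ℝ)) := by gcongr
      nlinarith
    · have h3 : 0 ≤ (N * r + 1 : ℝ) * (Q * (r * d)) := by positivity
      nlinarith

theorem abs_le_of_mem_partialSpectrum (hN : 0 < N) (hr : 0 < r) {n : ℕ} {x : ℝ}
    (hx : x ∈ partialSpectrum N r n) :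
    ((N * r : ℕ) : ℝ)⁻¹ ^ n * |x| ≤ (N * r : ℕ) / ((N * r : ℕ) + 1) := by
  obtain ⟨h1, h2⟩ := partialSpectrum_bounds hN hr n x hx
  push_cast
  have hq1 : (1 : ℝ) ≤ N * r := by exact_mod_cast Nat.mul_pos hN hr
  have hQ : (0 : ℝ) < (N * r) ^ n := by positivity
  have habs : |x| = |(-1) ^ n * x| := by rw [abs_mul, abs_pow, abs_neg, abs_one, one_pow, one_mul]
  rw [inv_pow, ← div_eq_inv_mul, div_le_div_iff₀ hQ (by positivity), habs, mul_comm,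
    ← abs_of_pos (by positivity : (0 : ℝ) < N * r + 1), ← abs_mul,
    abs_le]
  constructor
  · exact h1
  · nlinarith

theorem partialSpectrum_mono (hN : 0 < N) : Monotone (partialSpectrum N r) := by
  classical
  refine monotone_nat_of_le_succ fun n x hx => ?_
  rw [partialSpectrum, Finset.mem_image]
  exact ⟨(x, 0), Finset.mem_product.2 ⟨hx, Finset.mem_range.2 hN⟩, by simp⟩

/-- The union of the partial spectra satisfies Parseval's identity: the identity holds for the first
`n` factors on the `n`-th partial spectrum, and the remaining factor `F (q⁻ⁿ ·)` is bounded below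
there, so that dominated convergence applies. -/
theorem isParsevalSet_iUnion (hN : 1 < N) (hr : 0 < r) :
    IsParsevalSet ((N * r : ℕ) : ℝ)⁻¹ N (⋃ n, (partialSpectrum N r n : Set ℝ)) := by
  classical
  have hN0 : 0 < N := by omega
  obtain ⟨q, hq⟩ : ∃ q, q = N * r := ⟨_, rfl⟩
  have hq1 : 1 < q := hq ▸ (lt_of_lt_of_le hN (Nat.le_mul_of_pos_right N hr))
  have hNq : N ≤ q := hq ▸ Nat.le_mul_of_pos_right N hr
  have hqR : (1 : ℝ) < q := by exact_mod_cast hq1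
  have h0 : (0 : ℝ) < (q : ℝ)⁻¹ := by positivity
  have h1 : (q : ℝ)⁻¹ < 1 := inv_lt_one_of_one_lt₀ hqR
  rw [← hq]
  set F := fourierSelfSimilar (q : ℝ)⁻¹ N with hF
  set P : ℕ → Finset ℝ := partialSpectrum N r with hP
  have hPmono : Monotone P := partialSpectrum_mono hN0
  have hsum : ∀ n ξ, ∑ x ∈ P n, ‖partialTransform N q n (ξ + x)‖ ^ 2 = 1 := fun n =>
    hq ▸ sum_partialSpectrum hN0 hr n
  have hfac : ∀ n t, ‖F t‖ ^ 2 =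
      ‖partialTransform N q n t‖ ^ 2 * ‖F ((q : ℝ)⁻¹ ^ n * t)‖ ^ 2 := by
    intro n t
    rw [hF, fourierSelfSimilar_eq_prod h0 h1 hN0 n t, norm_mul, mul_pow]
    rfl
  have hle : ∀ n t, ‖F t‖ ^ 2 ≤ ‖partialTransform N q n t‖ ^ 2 := fun n t => by
    rw [hfac n t]
    exact mul_le_of_le_one_right (by positivity)
      (pow_le_one₀ (norm_nonneg _) (norm_fourierSelfSimilar_le_one h0 h1 hN0 _))
  refine ⟨fun x hx y hy hxy => ?_, fun ξ => ?_⟩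
  · rw [Set.mem_iUnion] at hx hy
    obtain ⟨m, hm⟩ := hx
    obtain ⟨n, hn⟩ := hy
    have h2 := partialTransform_sub_eq_zero hN0 (hsum (max m n))
      (hPmono (le_max_left m n) hm) (hPmono (le_max_right m n) hn) hxy
    have h3 := hfac (max m n) (x - y)
    rw [h2, norm_zero, zero_pow two_ne_zero, zero_mul, sq_eq_zero_iff, norm_eq_zero] at h3
    exact h3
  rw [show (fun l : (⋃ n, (P n : Set ℝ) : Set ℝ) => ‖F (ξ + l)‖ ^ 2) =
    (fun x : ℝ => ‖F (ξ + x)‖ ^ 2) ∘ Subtype.val from rfl, hasSum_subtype_iff_indicator]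
  set G : ℝ → ℝ := (⋃ n, (P n : Set ℝ)).indicator fun x : ℝ => ‖F (ξ + x)‖ ^ 2 with hG
  have hG0 : ∀ x, 0 ≤ G x := fun x => Set.indicator_nonneg (fun _ _ => by positivity) x
  have hGsum : Summable G := by
    refine summable_of_sum_le hG0 (c := 1) fun s => ?_
    obtain ⟨n, hn⟩ : ∃ n, ∀ x ∈ s, x ∈ ⋃ n, (P n : Set ℝ) → x ∈ P n := by
      have hex : ∀ x, ∃ n, x ∈ ⋃ n, (P n : Set ℝ) → x ∈ P n := by
        intro x
        by_cases hx : x ∈ ⋃ n, (P n : Set ℝ)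
        · obtain ⟨n, hn⟩ := Set.mem_iUnion.1 hx
          exact ⟨n, fun _ => hn⟩
        · exact ⟨0, fun h => absurd h hx⟩
      choose n hn using hex
      exact ⟨s.sup n, fun x hx hxU => hPmono (Finset.le_sup hx) (hn x hxU)⟩
    calc ∑ x ∈ s, G x ≤ ∑ x ∈ s, if x ∈ P n then ‖partialTransform N q n (ξ + x)‖ ^ 2 else 0 := by
          refine Finset.sum_le_sum fun x hx => ?_
          by_cases hxU : x ∈ ⋃ n, (P n : Set ℝ)
          · rw [hG, Set.indicator_of_mem hxU, if_pos (hn x hx hxU)]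
            exact hle n _
          · rw [hG, Set.indicator_of_notMem hxU]
            positivity
      _ ≤ ∑ x ∈ P n, ‖partialTransform N q n (ξ + x)‖ ^ 2 := by
          rw [← Finset.sum_filter]
          exact Finset.sum_le_sum_of_subset_of_nonneg
            (fun x hx => (Finset.mem_filter.1 hx).2) fun _ _ _ => by positivity
      _ = 1 := hsum n ξ
  -- a lower bound for the remaining factor
  set b : ℝ := (q : ℝ) / (q + 1) with hb
  have hb1 : b < 1 := by rw [hb, div_lt_one (by positivity)]; linarith
  obtain ⟨b', hbb', hb'1⟩ := exists_between hb1
  obtain ⟨κ, hκ, hκF⟩ : ∃ κ : ℝ, 0 < κ ∧ ∀ t, |t| ≤ b' → κ ≤ ‖F t‖ ^ 2 := by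
    have hne : (Set.Icc (-b') b').Nonempty :=
      Set.nonempty_Icc.2 (by have : 0 < b := by positivity
                             linarith)
    obtain ⟨t₀, ht₀, hmin⟩ := isCompact_Icc.exists_isMinOn hne
      ((continuous_fourierSelfSimilar h0 h1 hN0).norm.pow 2).continuousOn
    refine ⟨‖F t₀‖ ^ 2, ?_, fun t ht => hmin (abs_le.1 ht)⟩
    have hFt : F t₀ ≠ 0 := by
      intro hz
      obtain ⟨k, hk⟩ := exists_isLevel h0 h1 hN0 hz
      have h2 := hk.le_abs h0 hN0
      rw [inv_inv] at h2
      have h3 : |t₀| < 1 := (abs_le.2 ht₀).trans_lt hb'1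
      have h4 : (q : ℝ) ≤ (q : ℝ) ^ k := le_self_pow₀ hqR.le (by have := hk.1; omega)
      have h5 : (N : ℝ) ≤ q := by exact_mod_cast hNq
      have h6 : (0 : ℝ) < N := by exact_mod_cast hN0
      nlinarith
    positivity
  have hlim0 : ∀ t : ℝ, Tendsto (fun n : ℕ => (q : ℝ)⁻¹ ^ n * t) atTop (𝓝 0) := fun t => by
    simpa using (tendsto_pow_atTop_nhds_zero_of_lt_one h0.le h1).mul_const t
  have hlarge : ∀ᶠ n : ℕ in atTop, ∀ x ∈ P n, κ ≤ ‖F ((q : ℝ)⁻¹ ^ n * (ξ + x))‖ ^ 2 := by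
    have h2 := (hlim0 |ξ|).eventually (gt_mem_nhds (sub_pos.2 hbb'))
    filter_upwards [h2] with n hn x hx
    refine hκF _ ?_
    have h3 : (q : ℝ)⁻¹ ^ n * |x| ≤ b := by
      subst hq
      exact abs_le_of_mem_partialSpectrum hN0 hr hx
    rw [abs_mul, abs_of_pos (by positivity)]
    have h4 := mul_le_mul_of_nonneg_left (abs_add_le ξ x) (by positivity : 0 ≤ (q : ℝ)⁻¹ ^ n)
    linarith
  let f : ℕ → ℝ → ℝ := fun n x => if x ∈ P n then ‖partialTransform N q n (ξ + x)‖ ^ 2 else 0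
  have hconv : Tendsto (fun n => ∑' x, f n x) atTop (𝓝 (∑' x, G x)) := by
    refine tendsto_tsum_of_dominated_convergence (bound := fun x => κ⁻¹ * G x)
      (hGsum.mul_left _) (fun x => ?_) ?_
    · by_cases hxU : x ∈ ⋃ n, (P n : Set ℝ)
      · obtain ⟨m, hm⟩ := Set.mem_iUnion.1 hxU
        rw [hG, Set.indicator_of_mem hxU]
        have hF1 : Tendsto (fun n : ℕ => ‖F ((q : ℝ)⁻¹ ^ n * (ξ + x))‖ ^ 2) atTop (𝓝 1) := by
          have hF0 : F 0 = 1 := fourierSelfSimilar_zero h0 h1 hN0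
          have h2 : Tendsto (fun n : ℕ => ‖F ((q : ℝ)⁻¹ ^ n * (ξ + x))‖ ^ 2) atTop
              (𝓝 (‖F 0‖ ^ 2)) :=
            (((continuous_fourierSelfSimilar h0 h1 hN0).norm.pow 2).tendsto 0).comp
              (hlim0 (ξ + x))
          rwa [hF0, norm_one, one_pow] at h2
        have h3 := hF1.inv₀ one_ne_zero |>.const_mul (‖F (ξ + x)‖ ^ 2)
        rw [inv_one, mul_one] at h3
        refine h3.congr' ?_
        filter_upwards [eventually_ge_atTop m, hlarge] with n hn hn'
        have hxn : x ∈ P n := hPmono hn hm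
        have h4 := hκ.trans_le (hn' x hxn)
        simp only [f, if_pos hxn]
        rw [hfac n (ξ + x), mul_assoc, mul_inv_cancel₀ h4.ne', mul_one]
      · rw [hG, Set.indicator_of_notMem hxU]
        refine tendsto_const_nhds.congr fun n => ?_
        have hxn : x ∉ P n := fun h => hxU (Set.mem_iUnion.2 ⟨n, h⟩)
        simp only [f, if_neg hxn]
    · filter_upwards [hlarge] with n hn x
      by_cases hxn : x ∈ P n
      · have hxU : x ∈ ⋃ n, (P n : Set ℝ) := Set.mem_iUnion.2 ⟨n, hxn⟩
        simp only [f, if_pos hxn]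
        rw [Real.norm_of_nonneg (by positivity), hG, Set.indicator_of_mem hxU, hfac n (ξ + x),
          le_inv_mul_iff₀ hκ, mul_comm]
        exact mul_le_mul_of_nonneg_left (hn x hxn) (by positivity)
      · simp only [f, if_neg hxn, norm_zero]
        exact mul_nonneg (by positivity) (hG0 x)
  have hf1 : ∀ n, ∑' x, f n x = 1 := by
    intro n
    rw [tsum_eq_sum (s := P n) fun x hx => if_neg hx, ← hsum n ξ]
    exact Finset.sum_congr rfl fun x hx => if_pos hx
  simp only [hf1] at hconv
  rw [tendsto_nhds_unique tendsto_const_nhds hconv]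
  exact hGsum.hasSum

end

theorem theorem1p1 (N : ℕ) (hN : 1 < N) (ρ : ℝ) (hρ0 : 0 < ρ) (hρ1 : ρ < 1) :
    IsSpectralMeasure (selfSimilarMeasure ρ N) ↔
      ∃ q : ℕ, 1 < q ∧ N ∣ q ∧ ρ = 1 / (q : ℝ) := by
  have hN0 : 0 < N := by omega
  constructor
  · rintro ⟨Λ, hΛ⟩
    have h : IsParsevalSet ρ N Λ := hΛ.zero_and_hasSum hρ0 hρ1 hN0
    obtain ⟨s, hs⟩ := h.inv_eq_ratCast hρ0 hρ1 hN
    have hden := h.den_eq_one hρ0 hρ1 hN hs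
    have hs1 : 1 < s := by
      have := one_lt_inv₀ hρ0 |>.2 hρ1
      rw [hs] at this
      exact_mod_cast this
    obtain ⟨q, rfl⟩ : ∃ q : ℕ, s = q := by
      refine ⟨s.num.toNat, ?_⟩
      have h1 : (s.num : ℚ) = s := Rat.den_eq_one_iff s |>.1 hden
      have h2 : 0 ≤ s.num := Rat.num_nonneg.2 (by linarith)
      rw [← h1]
      exact_mod_cast (Int.toNat_of_nonneg h2).symm
    have hq : 1 < q := by exact_mod_cast hs1
    have hρ : ρ = (q : ℝ)⁻¹ := by
      rw [← inv_inv ρ, hs]; simp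
    subst hρ
    exact ⟨q, hq, h.dvd_of_inv_nat hq hN, (one_div _).symm⟩
  · rintro ⟨q, hq, ⟨r, rfl⟩, rfl⟩
    have hr : 0 < r := Nat.pos_of_ne_zero fun h => by simp [h] at hq
    rw [one_div] at hρ0 hρ1 ⊢
    exact ⟨_, (isParsevalSet_iUnion hN hr).isSpectrum hρ0 hρ1 hN0
      (Set.countable_iUnion fun n => (partialSpectrum N r n).countable_toSet)⟩
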